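/- **Setting.** Let $N,K,M\ge 0$ be integers, $\mathbf h_{u,1},\dots,\mathbf h_{u,K},\mathbf h_d\in\mathbb C^N$, $\beta_0,\dots,\beta_M\in\mathbb C$, $\theta_0,\dots,\theta_M\in\mathbb R$, $\pi$ a permutation of $\{1,\dots,K\}$, $P_u,P_b,\sigma_u,\sigma_d,B,\phi,\kappa>0$, $\omega_1,\dots,\omega_K\ge 0$, $\gamma_{s,\min}\ge 0$ and $\Gamma=\log_2(1+\gamma_{s,\min})$. For a wavelength $\lambda>0$ and an antenna spacing $d>0$ let $\mathbf a(\theta)=(e^{j\frac{2\pi}{\lambda}dn\sin\theta})_{n=0}^{N-1}$, $\mathbf H_s=\beta_0\mathbf a(\theta_0)\mathbf a(\theta_0)^T$, $\mathbf H_c=\sum_{m=1}^M\beta_m\mathbf a(\theta_m)\mathbf a(\theta_m)^T$, $\mathbf H=\mathbf H_s+\mathbf H_c$. For $\mathbf p\in\mathbb C^N$ put $$\mathbf R_k=\sum_{\pi(i)>\pi(k)}P_u\mathbf h_{u,i}\mathbf h_{u,i}^H+\mathbf H\mathbf p\mathbf p^H\mathbf H^H+\sigma_u^2\mathbf I,\qquad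 \mathbf R_c=\mathbf H_c\mathbf p\mathbf p^H\mathbf H_c^H+\sigma_u^2\mathbf I,$$ $$R_{u,k}=\log_2(1+P_u\mathbf h_{u,k}^H\mathbf R_k^{-1}\mathbf h_{u,k}),\quad R_d=\log_2(1+|\mathbf h_d^H\mathbf p|^2/\sigma_d^2),\quad R_s=\log_2(1+\mathbf p^H\mathbf H_s^H\mathbf R_c^{-1}\mathbf H_s\mathbf p).$$ For receivers $\mathbf w_{u,k},\mathbf w_s\in\mathbb C^N$, $w_d\in\mathbb C$ the mean square errors are $$e_{u,k}=\mathbf w_{u,k}^H(P_u\mathbf h_{u,k}\mathbf h_{u,k}^H+\mathbf R_k)\mathbf w_{u,k}-2\mathrm{Re}\{\sqrt{P_u}\,\mathbf w_{u,k}^H\mathbf h_{u,k}\}+1,$$ $$e_d=|w_d|^2(|\mathbf h_d^H\mathbf p|^2+\sigma_d^2)-2\mathrm{Re}\{w_d^*\mathbf h_d^H\mathbf p\}+1,$$ $$e_s=\mathbf w_s^H(\mathbf H_s\mathbf p\mathbf p^H\mathbf H_s^H+\mathbf R_c)\mathbf w_s-2\mathrm{Re}\{\mathbf w_s^H\mathbf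 H_s\mathbf p\}+1.$$ For positive weights $\varpi$ let $\varepsilon_\bullet=\varpi_\bullet e_\bullet-\log_2\varpi_\bullet$ for each of the streams $\bullet\in\{(u,1),\dots,(u,K),d,s\}$, and let $c=1/\ln 2+\log_2\ln 2$. The MMSE receivers $\mathbf w^{\rm MMSE}(\mathbf p)$ are $$\mathbf w_{u,k}=\sqrt{P_u}(P_u\mathbf h_{u,k}\mathbf h_{u,k}^H+\mathbf R_k)^{-1}\mathbf h_{u,k},\quad w_d=\frac{\mathbf h_d^H\mathbf p}{|\mathbf h_d^H\mathbf p|^2+\sigma_d^2},\quad \mathbf w_s=(\mathbf H_s\mathbf p\mathbf p^H\mathbf H_s^H+\mathbf R_c)^{-1}\mathbf H_s\mathbf p,$$ and the MMSE weights are $\varpi_\bullet^{\rm MMSE}(\mathbf p)=(e_\bullet^{\rm MMSE}\ln 2)^{-1}$, where $e_\bullet^{\rm MMSE}$ is $e_\bullet$ at the MMSE receiver. **Problems.** (P1.1): maximize $\sum_k\omega_k(r_{b,k}+r_{c,k})$ over $\mathbf r_b,\mathbf r_c\in\mathbb R^K$, $\mathbf p\in\mathbb C^N$ subject to $r_{b,k}+r_{c,k}\le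 BR_{u,k}$ for all $k$, $\sum_kr_{c,k}\le BR_d$, $\Gamma\le R_s$, $\sum_k\kappa(\phi r_{b,k})^3+\|\mathbf p\|_2^2\le P_b$, and $r_{b,k},r_{c,k}\ge 0$ for all $k$. (P1.2): the same objective, maximized over $(\boldsymbol\varpi,\mathbf w,\mathbf r_b,\mathbf r_c,\mathbf p)$ with $\boldsymbol\varpi>0$, the rates $R_{u,k},R_d,R_s$ in the constraints being replaced by $c-\varepsilon_{u,k}$, $c-\varepsilon_d$, $c-\varepsilon_s$. KKT points are taken with respect to all the (real and imaginary parts of the) variables of the problem. **Algorithm.** From $\mathbf p^{[0]}$, for $n=0,1,\dots$: $\boldsymbol\varpi^{[n+1]}=\boldsymbol\varpi^{\rm MMSE}(\mathbf p^{[n]})$, $\mathbf w^{[n+1]}=\mathbf w^{\rm MMSE}(\mathbf p^{[n]})$, and $x^{[n+1]}=(\mathbf r_b^{[n+1]},\mathbf r_c^{[n+1]},\mathbf p^{[n+1]})$ is an optimal solution (any one) of (P1.2) with $\boldsymbol\varpi=\boldsymbol\varpi^{[n+1]}$, $\mathbf w=\mathbf w^{[n+1]}$ fixed. **Proposition 2.**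 If the first subproblem is feasible, then the algorithm can be run forever. For every such infinite run (with any choice of the optimal solutions): 1. every subproblem has a convex feasible set; the objective values $\tilde R^{[n]}$, $n\ge 1$, are non-decreasing and bounded, hence converge; 2. the sequence $z^{[n]}=(\boldsymbol\varpi^{[n+1]},\mathbf w^{[n+1]},x^{[n]})$ is bounded and has a cluster point, and the objective value of every cluster point is $\lim_n\tilde R^{[n]}$; 3. every cluster point $z^\star=(\boldsymbol\varpi^\star,\mathbf w^\star,\mathbf r_b^\star,\mathbf r_c^\star,\mathbf p^\star)$ of it satisfies $\boldsymbol\varpi^\star=\boldsymbol\varpi^{\rm MMSE}(\mathbf p^\star)$ and $\mathbf w^\star=\mathbf w^{\rm MMSE}(\mathbf p^\star)$ and is feasible for (P1.2), and $(\mathbf r_b^\star,\mathbf r_c^\star,\mathbf p^\star)$ is feasible for (P1.1); if moreover the convex problem (P1.2) with $\boldsymbol\varpi=\boldsymbol\varpi^\star$, $\mathbf w=\mathbf w^\star$ fixed satisfies Slater's condition (some point satisfies all its inequality constraints strictly), then $z^\star$ is a KKT point of (P1.2) and $(\mathbf r_b^\star,\mathbf r_c^\star,\mathbf p^\star)$ is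 a KKT point of (P1.1); 4. if $(\boldsymbol\varpi^{[n]},\mathbf w^{[n]},x^{[n]})$ converges, its limit satisfies the same MMSE conditions and, under the same Slater condition, the same KKT conclusions; 5. if the Slater condition of item 3 holds at every cluster point, then the distance from $z^{[n]}$ to the set of KKT points of (P1.2) that satisfy the MMSE conditions (and whose part $(\mathbf r_b,\mathbf r_c,\mathbf p)$ is a KKT point of (P1.1)) tends to $0$. -/

import Mathlib

open Filter Topology
open scoped Matrix

noncomputable section

namespace JCSMC

/-- A point `x` is a KKT point of the problem: maximize `f` subject to `g i ≤ 0` for all `i`.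
Feasibility, nonnegative multipliers, complementary slackness, and stationarity of the
Lagrangian, all derivatives being real Fréchet derivatives (so that the gradient in a complex
variable is the gradient in its real and imaginary parts). -/
def IsKKTPoint {E : Type*} [NormedAddCommGroup E] [NormedSpace ℝ E] {ι : Type*} [Fintype ι]
    (f : E → ℝ) (g : ι → E → ℝ) (x : E) : Prop :=
  DifferentiableAt ℝ f x ∧ (∀ i, DifferentiableAt ℝ (g i) x) ∧ (∀ i, g i x ≤ 0) ∧
    ∃ μ : ι → ℝ, (∀ i, 0 ≤ μ i) ∧ (∀ i, μ i * g i x = 0) ∧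
      fderiv ℝ f x = ∑ i, μ i • fderiv ℝ (g i) x

/-- The data of the NOMA-aided system: `N` antennas at the base station (BS), `K` users,
one target (index `0`) and `M` clutter sources (indices `1, …, M`). -/
structure System (N K M : ℕ) where
  /-- user-to-BS channels -/
  hu : Fin K → Fin N → ℂ
  /-- channel between the BS and the cloud server (CS) -/
  hd : Fin N → ℂ
  /-- complex round-trip coefficients of the target and of the clutter sources -/
  β : Fin (M + 1) → ℂ
  /-- angles of the target and of the clutter sources -/
  θ : Fin (M + 1) → ℝ
  /-- wavelength -/
  wavelength : ℝ
  /-- antenna spacing -/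
  spacing : ℝ
  /-- decoding order of the users -/
  π : Equiv.Perm (Fin K)
  /-- transmit power of each user -/
  Pu : ℝ
  /-- power budget of the BS -/
  Pb : ℝ
  /-- standard deviation of the noise at the BS -/
  σu : ℝ
  /-- standard deviation of the noise at the CS -/
  σd : ℝ
  /-- bandwidth -/
  B : ℝ
  /-- computation cycles per bit -/
  φ : ℝ
  /-- power factor of the BS processor -/
  κ : ℝ
  /-- priorities of the users -/
  ω : Fin K → ℝ
  /-- minimum sensing SINR -/
  γmin : ℝ
  wavelength_pos : 0 < wavelength
  spacing_pos : 0 < spacing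
  Pu_pos : 0 < Pu
  Pb_pos : 0 < Pb
  σu_pos : 0 < σu
  σd_pos : 0 < σd
  B_pos : 0 < B
  φ_pos : 0 < φ
  κ_pos : 0 < κ
  ω_nonneg : ∀ k, 0 ≤ ω k
  γmin_nonneg : 0 ≤ γmin

/-- Weights of the AWMSEs: `(ϖ_u, ϖ_s, ϖ_d)`. -/
abbrev Weights (K : ℕ) : Type := (Fin K → ℝ) × ℝ × ℝ

/-- Receivers: `(w_u, w_s, w_d)`. -/
abbrev Receivers (N K : ℕ) : Type := (Fin K → Fin N → ℂ) × (Fin N → ℂ) × ℂ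

/-- Resource allocation and beamformer: `(r_b, r_c, p)`. -/
abbrev Alloc (N K : ℕ) : Type := (Fin K → ℝ) × (Fin K → ℝ) × (Fin N → ℂ)

/-- All the variables of the reformulated problem: `(ϖ, w, (r_b, r_c, p))`. -/
abbrev Point (N K : ℕ) : Type := Weights K × Receivers N K × Alloc N K

/-- Names of the constraints. -/
inductive Con (K : ℕ) : Type
  | uplink (k : Fin K)
  | downlink
  | sensing
  | power
  | nonnegB (k : Fin K)
  | nonnegC (k : Fin K)
  deriving DecidableEq, Fintype

namespace System

variable {N K M : ℕ} (S : System N K M)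

/-- Steering vector of the uniform linear array. -/
def steer (t : ℝ) : Fin N → ℂ := fun n =>
  Complex.exp (Complex.I *
    ((2 * Real.pi / S.wavelength * S.spacing * (n : ℕ) * Real.sin t : ℝ) : ℂ))

/-- Response of the target, `β₀ a(θ₀) a(θ₀)ᵀ`. -/
def Hs : Matrix (Fin N) (Fin N) ℂ :=
  S.β 0 • Matrix.vecMulVec (S.steer (S.θ 0)) (S.steer (S.θ 0))

/-- Response of the clutter, `∑_{m=1}^M β_m a(θ_m) a(θ_m)ᵀ`. -/
def Hc : Matrix (Fin N) (Fin N) ℂ :=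
  ∑ m : Fin M, S.β m.succ •
    Matrix.vecMulVec (S.steer (S.θ m.succ)) (S.steer (S.θ m.succ))

/-- Covariance of the interference plus noise seen by user `k`. -/
def covU (k : Fin K) (p : Fin N → ℂ) : Matrix (Fin N) (Fin N) ℂ :=
  (∑ i ∈ Finset.univ.filter (fun i => S.π k < S.π i),
      (S.Pu : ℂ) • Matrix.vecMulVec (S.hu i) (star (S.hu i)))
    + (S.Hs + S.Hc) * Matrix.vecMulVec p (star p) * (S.Hs + S.Hc)ᴴ
    + ((S.σu ^ 2 : ℝ) : ℂ) • (1 : Matrix (Fin N) (Fin N) ℂ)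

/-- Covariance of the clutter plus noise. -/
def covC (p : Fin N → ℂ) : Matrix (Fin N) (Fin N) ℂ :=
  S.Hc * Matrix.vecMulVec p (star p) * (S.Hc)ᴴ
    + ((S.σu ^ 2 : ℝ) : ℂ) • (1 : Matrix (Fin N) (Fin N) ℂ)

/-! ### Achievable rates (bit/s/Hz) -/

/-- Rate from user `k` to the BS. -/
def rateU (k : Fin K) (p : Fin N → ℂ) : ℝ :=
  Real.logb 2 (1 + S.Pu * (star (S.hu k) ⬝ᵥ ((S.covU k p)⁻¹ *ᵥ S.hu k)).re)

/-- Rate from the BS to the CS. -/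
def rateD (p : Fin N → ℂ) : ℝ :=
  Real.logb 2 (1 + ‖star S.hd ⬝ᵥ p‖ ^ 2 / S.σd ^ 2)

/-- Sensing SINR. -/
def sinrS (p : Fin N → ℂ) : ℝ :=
  (star (S.Hs *ᵥ p) ⬝ᵥ ((S.covC p)⁻¹ *ᵥ (S.Hs *ᵥ p))).re

/-- Rate of the equivalent communication model of sensing. -/
def rateS (p : Fin N → ℂ) : ℝ := Real.logb 2 (1 + S.sinrS p)

/-- `Γ_min = log₂ (1 + γ_min)`. -/
def Γmin : ℝ := Real.logb 2 (1 + S.γmin)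

/-! ### Mean square errors and augmented weighted mean square errors -/

/-- MSE of the stream of user `k` with receiver `w`. -/
def mseU (k : Fin K) (w p : Fin N → ℂ) : ℝ :=
  (star w ⬝ᵥ (((S.Pu : ℂ) • Matrix.vecMulVec (S.hu k) (star (S.hu k)) + S.covU k p) *ᵥ w)).re
    - 2 * ((Real.sqrt S.Pu : ℂ) * (star w ⬝ᵥ S.hu k)).re + 1

/-- MSE of the stream at the CS with receiver `w`. -/
def mseD (w : ℂ) (p : Fin N → ℂ) : ℝ :=
  ‖w‖ ^ 2 * (‖star S.hd ⬝ᵥ p‖ ^ 2 + S.σd ^ 2) - 2 * (star w * (star S.hd ⬝ᵥ p)).re + 1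

/-- MSE of the virtual sensing stream with receiver `w`. -/
def mseS (w p : Fin N → ℂ) : ℝ :=
  (star w ⬝ᵥ ((S.Hs * Matrix.vecMulVec p (star p) * (S.Hs)ᴴ + S.covC p) *ᵥ w)).re
    - 2 * (star w ⬝ᵥ (S.Hs *ᵥ p)).re + 1

/-- AWMSE with weight `ϖ` of a stream with MSE `e`. -/
def _root_.JCSMC.awmse (ϖ e : ℝ) : ℝ := ϖ * e - Real.logb 2 ϖ

/-- The constant `c = 1 / ln 2 + log₂ (ln 2)`. -/
def _root_.JCSMC.cst : ℝ := 1 / Real.log 2 + Real.logb 2 (Real.log 2)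

/-! ### MMSE receivers and weights as functions of the beamformer -/

/-- MMSE receiver of user `k`. -/
def recU (k : Fin K) (p : Fin N → ℂ) : Fin N → ℂ :=
  (Real.sqrt S.Pu : ℂ) •
    (((S.Pu : ℂ) • Matrix.vecMulVec (S.hu k) (star (S.hu k)) + S.covU k p)⁻¹ *ᵥ S.hu k)

/-- MMSE receiver at the CS. -/
def recD (p : Fin N → ℂ) : ℂ :=
  ((‖star S.hd ⬝ᵥ p‖ ^ 2 + S.σd ^ 2 : ℝ) : ℂ)⁻¹ * (star S.hd ⬝ᵥ p)

/-- MMSE receiver of the virtual sensing stream. -/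
def recS (p : Fin N → ℂ) : Fin N → ℂ :=
  (S.Hs * Matrix.vecMulVec p (star p) * (S.Hs)ᴴ + S.covC p)⁻¹ *ᵥ (S.Hs *ᵥ p)

/-- The MMSE receivers. -/
def mmseReceivers (p : Fin N → ℂ) : Receivers N K :=
  (fun k => S.recU k p, S.recS p, S.recD p)

/-- The MMSE weights `(e^MMSE ln 2)⁻¹`, where `e^MMSE` is the MSE of the MMSE receiver. -/
def mmseWeights (p : Fin N → ℂ) : Weights K :=
  (fun k => (S.mseU k (S.recU k p) p * Real.log 2)⁻¹,
    (S.mseS (S.recS p) p * Real.log 2)⁻¹,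
    (S.mseD (S.recD p) p * Real.log 2)⁻¹)

/-! ### The optimization problems -/

/-- The computation rate `∑ ω_k (r_{b,k} + r_{c,k})`. -/
def objective (x : Alloc N K) : ℝ := ∑ k, S.ω k * (x.1 k + x.2.1 k)

/-- The constraints, in the form `… ≤ 0`, when the rates (or the lower bounds that replace them)
are `Ru`, `Rd` and `Rs`. -/
def constraintOf (Ru : Fin K → ℝ) (Rd Rs : ℝ) (x : Alloc N K) : Con K → ℝ
  | .uplink k => x.1 k + x.2.1 k - S.B * Ru k
  | .downlink => ∑ k, x.2.1 k - S.B * Rd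
  | .sensing => S.Γmin - Rs
  | .power => ∑ k, S.κ * (S.φ * x.1 k) ^ 3 + ∑ n, ‖x.2.2 n‖ ^ 2 - S.Pb
  | .nonnegB k => - x.1 k
  | .nonnegC k => - x.2.1 k

/-- Constraints of the original problem, which involve the achievable rates. -/
def conRate (i : Con K) (x : Alloc N K) : ℝ :=
  S.constraintOf (fun k => S.rateU k x.2.2) (S.rateD x.2.2) (S.rateS x.2.2) x i

/-- Constraints of the reformulated problem: each rate is replaced by `c - ε`, where `ε`
is the AWMSE of the stream. -/
def conMSE (i : Con K) (z : Point N K) : ℝ :=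
  S.constraintOf
    (fun k => cst - awmse (z.1.1 k) (S.mseU k (z.2.1.1 k) z.2.2.2.2))
    (cst - awmse z.1.2.2 (S.mseD z.2.1.2.2 z.2.2.2.2))
    (cst - awmse z.1.2.1 (S.mseS z.2.1.2.1 z.2.2.2.2))
    z.2.2 i

/-- KKT points of the original problem: maximize the computation rate over `(r_b, r_c, p)`. -/
def IsKKTRate (x : Alloc N K) : Prop := IsKKTPoint S.objective S.conRate x

/-- KKT points of the reformulated problem: maximize the computation rate over all of `(ϖ, w, r_b, r_c, p)`, the
weights being positive. -/
def IsKKTMSE (z : Point N K) : Prop :=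
  ((∀ k, 0 < z.1.1 k) ∧ 0 < z.1.2.1 ∧ 0 < z.1.2.2) ∧
    IsKKTPoint (fun z : Point N K => S.objective z.2.2) S.conMSE z

/-- The weights and the receivers take their MMSE values for the beamformer. -/
def IsMMSE (z : Point N K) : Prop :=
  z.1 = S.mmseWeights z.2.2.2.2 ∧ z.2.1 = S.mmseReceivers z.2.2.2.2

/-- Feasible set of the reformulated problem for fixed weights and receivers. -/
def subFeasible (ϖ : Weights K) (w : Receivers N K) : Set (Alloc N K) :=
  {x | ∀ i, S.conMSE i (ϖ, w, x) ≤ 0}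

/-- Slater's condition for the reformulated problem with fixed weights and receivers. -/
def Slater (ϖ : Weights K) (w : Receivers N K) : Prop :=
  ∃ x : Alloc N K, ∀ i, S.conMSE i (ϖ, w, x) < 0

/-- `ϖ n`, `w n`, `x n = (r_b, r_c, p)` are the successive iterates of the alternating
optimization algorithm. Of the entries with index `0`, the algorithm uses only the beamformer
`(x 0).2.2`. -/
structure IsRun (ϖ : ℕ → Weights K) (w : ℕ → Receivers N K) (x : ℕ → Alloc N K) : Prop where
  weights : ∀ n, ϖ (n + 1) = S.mmseWeights (x n).2.2
  receivers : ∀ n, w (n + 1) = S.mmseReceivers (x n).2.2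
  feasible : ∀ n, x (n + 1) ∈ S.subFeasible (ϖ (n + 1)) (w (n + 1))
  optimal : ∀ n, ∀ y ∈ S.subFeasible (ϖ (n + 1)) (w (n + 1)),
    S.objective y ≤ S.objective (x (n + 1))

end System

end JCSMC

end

/-! The engine is a tight minorant. For any receiver and any positive weight, `c - ε` is at most the
rate, with equality at the MMSE receiver and weight. Two facts give this: completing the square with
the Sherman-Morrison formula shows that the least MSE is `1 / (1 + SINR)`, and `log t ≤ t - 1` at `t
= ϖ e ln 2` is sharp exactly for `ϖ = 1 / (e ln 2)`. Hence every subproblem has its feasible set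
inside the compact feasible set of the rate problem (`conRate_le_conMSE`), and updating weights and
receivers keeps the current allocation feasible (`mem_subFeasible_mmse`). So the run never stops,
and the objective values increase and are bounded.

The points `(ϖ (n + 1), w (n + 1), x n)` lie on the graph of the continuous MMSE map, over a compact
set as soon as `n ≥ 1`. Cluster points therefore exist, satisfy the MMSE conditions and are
feasible. At a cluster point, an allocation strictly feasible for the limiting subproblem remains
feasible for infinitely many subproblems, so its value is at most the limit value (`objective_le`).

For KKT, two differentiable functions that touch, one above the other, have equal derivatives
(`fderiv_eq_of_touch`). At an MMSE point the constraints of the rate problem, of the convex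
subproblem and of the full reformulation thus agree to first order, and the derivatives in the
weights and receivers vanish. Slater's condition and convexity provide a Mangasarian-Fromovitz
direction, a separation theorem produces multipliers for the rate problem, and the same multipliers
serve the reformulation. -/

noncomputable section

namespace JCSMC

/-! ### Quadratic mean square errors and the least MSE -/

section Mse

open scoped ComplexOrder

variable {n : Type*} [Fintype n] [DecidableEq n]

/-- The mean square error `wᴴ A w - 2 Re (wᴴ h) + 1` of a receiver `w`. -/
def quadMse (A : Matrix n n ℂ) (h w : n → ℂ) : ℝ :=
  (star w ⬝ᵥ (A *ᵥ w)).re - 2 * (star w ⬝ᵥ h).re + 1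

omit [DecidableEq n] in
theorem re_star_dotProduct_comm (v w : n → ℂ) : (star v ⬝ᵥ w).re = (star w ⬝ᵥ v).re := by
  rw [Matrix.star_dotProduct, Complex.star_def, Complex.conj_re, dotProduct_comm, dotProduct_comm v]

omit [DecidableEq n] in
-- Completing the square around the solution of the normal equation.
theorem quadMse_eq_add {A : Matrix n n ℂ} (hA : A.PosDef) {h w₀ : n → ℂ} (h₀ : A *ᵥ w₀ = h)
    (w : n → ℂ) :
    quadMse A h w = (star (w - w₀) ⬝ᵥ (A *ᵥ (w - w₀))).re + (1 - (star h ⬝ᵥ w₀).re) := by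
  have e1 : star w₀ ⬝ᵥ (A *ᵥ w) = star h ⬝ᵥ w := by
    rw [← h₀, Matrix.star_mulVec, hA.isHermitian.eq, Matrix.dotProduct_mulVec]
  have e2 : (star h ⬝ᵥ w).re = (star w ⬝ᵥ h).re := by
    rw [re_star_dotProduct_comm]
  have e3 : (star h ⬝ᵥ w₀).re = (star w₀ ⬝ᵥ h).re := by
    rw [re_star_dotProduct_comm]
  simp only [quadMse, Matrix.mulVec_sub, star_sub, sub_dotProduct, dotProduct_sub, h₀, e1,
    Complex.sub_re, e2, e3]
  ring

theorem dotProduct_inv_mulVec_nonneg {R : Matrix n n ℂ} (hR : R.PosDef) (h : n → ℂ) :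
    0 ≤ (star h ⬝ᵥ (R⁻¹ *ᵥ h)).re :=
  (Complex.nonneg_iff.1 (hR.inv.posSemidef.dotProduct_mulVec_nonneg h)).1

omit [DecidableEq n] in
theorem posDef_vecMulVec_add {R : Matrix n n ℂ} (hR : R.PosDef) (h : n → ℂ) :
    (Matrix.vecMulVec h (star h) + R).PosDef :=
  Matrix.PosDef.posSemidef_add (Matrix.posSemidef_vecMulVec_self_star h) hR

/-- With `α = hᴴ R⁻¹ h`, Sherman-Morrison gives `(h hᴴ + R)⁻¹ h = (1 + α)⁻¹ R⁻¹ h`, so the remainder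
of the completed square is `1 - α / (1 + α)`. This is the bridge from MSE to SINR. -/
theorem quadMse_vecMulVec_add {R : Matrix n n ℂ} (hR : R.PosDef) (h w : n → ℂ) :
    (1 + (star h ⬝ᵥ (R⁻¹ *ᵥ h)).re)⁻¹ ≤ quadMse (Matrix.vecMulVec h (star h) + R) h w ∧
    quadMse (Matrix.vecMulVec h (star h) + R) h ((Matrix.vecMulVec h (star h) + R)⁻¹ *ᵥ h) =
      (1 + (star h ⬝ᵥ (R⁻¹ *ᵥ h)).re)⁻¹ := by
  have hA := posDef_vecMulVec_add hR h
  set A := Matrix.vecMulVec h (star h) + R with hAdef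
  have hα := Complex.nonneg_iff.1 (hR.inv.posSemidef.dotProduct_mulVec_nonneg h)
  set α := (star h ⬝ᵥ (R⁻¹ *ᵥ h)).re with hαdef
  have hαe : star h ⬝ᵥ (R⁻¹ *ᵥ h) = (α : ℂ) := Complex.ext rfl (by simpa using hα.2.symm)
  have h1 : (1 + α) ≠ 0 := by linarith [hα.1]
  have h1' : (1 + α : ℂ) ≠ 0 := by exact_mod_cast h1
  have hRdet : IsUnit R.det := (Matrix.isUnit_iff_isUnit_det R).1 hR.isUnit
  have hAdet : IsUnit A.det := (Matrix.isUnit_iff_isUnit_det A).1 hA.isUnit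
  set w₀ : n → ℂ := ((1 + α : ℂ)⁻¹) • (R⁻¹ *ᵥ h) with hw₀
  have hAw : A *ᵥ w₀ = h := by
    rw [hw₀, Matrix.mulVec_smul, hAdef, Matrix.add_mulVec, Matrix.mulVec_mulVec h R,
      Matrix.mul_nonsing_inv _ hRdet, Matrix.one_mulVec, Matrix.vecMulVec_mulVec, hαe]
    ext i
    simp
    field_simp
    ring
  have hinv : A⁻¹ *ᵥ h = w₀ := by
    rw [← hAw, Matrix.mulVec_mulVec, Matrix.nonsing_inv_mul _ hAdet, Matrix.one_mulVec]
  have hval : 1 - (star h ⬝ᵥ w₀).re = (1 + α)⁻¹ := by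
    rw [hw₀, dotProduct_smul, hαe, smul_eq_mul]
    have : ((1 + α : ℂ)⁻¹ * α) = (((1 + α)⁻¹ * α : ℝ) : ℂ) := by push_cast; ring
    rw [this, Complex.ofReal_re]
    field_simp
    ring
  rw [hinv, quadMse_eq_add hA hAw, quadMse_eq_add hA hAw, hval]
  refine ⟨?_, by simp⟩
  have := (Complex.nonneg_iff.1 (hA.posSemidef.dotProduct_mulVec_nonneg (w - w₀))).1
  linarith

end Mse

/-! ### Augmented weighted mean square errors -/

/-- This is `log t ≤ t - 1` at `t = ϖ e ln 2`, divided by `ln 2`; the constant `cst` is what makes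
the bound sharp at `t = 1`. -/
theorem cst_sub_awmse_le {ϖ e : ℝ} (hϖ : 0 < ϖ) (he : 0 < e) :
    cst - awmse ϖ e ≤ - Real.logb 2 e := by
  have hl : 0 < Real.log 2 := Real.log_pos one_lt_two
  have h := Real.log_le_sub_one_of_pos (show 0 < ϖ * e * Real.log 2 by positivity)
  rw [Real.log_mul (by positivity) hl.ne', Real.log_mul hϖ.ne' he.ne'] at h
  simp only [cst, awmse, Real.logb]
  rw [← sub_nonneg]
  have : -(Real.log e / Real.log 2) - (1 / Real.log 2 + Real.log (Real.log 2) / Real.log 2 -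
      (ϖ * e - Real.log ϖ / Real.log 2)) = (ϖ * e * Real.log 2 - 1 - (Real.log ϖ + Real.log e +
      Real.log (Real.log 2))) / Real.log 2 := by
    field_simp
    ring
  rw [this]
  exact div_nonneg (by linarith) hl.le

theorem cst_sub_awmse_eq {e : ℝ} (he : 0 < e) :
    cst - awmse ((e * Real.log 2)⁻¹) e = - Real.logb 2 e := by
  have hl : 0 < Real.log 2 := Real.log_pos one_lt_two
  simp only [cst, awmse, Real.logb]
  rw [Real.log_inv, Real.log_mul he.ne' hl.ne']
  field_simp
  ring

theorem awmse_mono {ϖ e e' : ℝ} (hϖ : 0 ≤ ϖ) (h : e ≤ e') : awmse ϖ e ≤ awmse ϖ e' := by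
  unfold awmse
  gcongr

/-! ### Differentiability of matrix expressions -/

section Diff

variable {E : Type*} [NormedAddCommGroup E] [NormedSpace ℝ E]
  {n m : Type*} [Fintype n]

theorem differentiable_dotProduct {f g : E → n → ℂ} (hf : Differentiable ℝ f)
    (hg : Differentiable ℝ g) : Differentiable ℝ fun x => f x ⬝ᵥ g x := by
  unfold dotProduct
  rw [differentiable_pi] at hf hg
  exact Differentiable.fun_sum fun i _ => (hf i).fun_mul (hg i)

omit [Fintype n] in
theorem differentiable_star {f : E → n → ℂ} (hf : Differentiable ℝ f) :
    Differentiable ℝ fun x => star (f x) := by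
  rw [differentiable_pi] at hf ⊢
  intro i
  exact (Complex.conjCLE.differentiable).comp (hf i)

theorem differentiable_mulVec {A : E → Matrix m n ℂ} {v : E → n → ℂ}
    (hA : ∀ i j, Differentiable ℝ fun x => A x i j) (hv : Differentiable ℝ v) :
    Differentiable ℝ fun x => A x *ᵥ v x := by
  rw [differentiable_pi] at *
  intro i
  exact differentiable_dotProduct (differentiable_pi.2 fun j => hA i j) (differentiable_pi.2 hv)

theorem differentiable_const_mulVec (A : Matrix m n ℂ) {v : E → n → ℂ}
    (hv : Differentiable ℝ v) : Differentiable ℝ fun x => A *ᵥ v x :=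
  differentiable_mulVec (fun _ _ => differentiable_const _) hv

theorem differentiable_re {f : E → ℂ} (hf : Differentiable ℝ f) :
    Differentiable ℝ fun x => (f x).re :=
  Complex.reCLM.differentiable.comp hf

variable [DecidableEq n]

theorem differentiable_det {A : E → Matrix n n ℂ}
    (hA : ∀ i j, Differentiable ℝ fun x => A x i j) : Differentiable ℝ fun x => (A x).det := by
  simp only [Matrix.det_apply]
  refine Differentiable.fun_sum fun σ _ => Differentiable.const_smul ?_ _
  exact fun x => (HasFDerivAt.finsetProd fun i _ =>
    (hA (σ i) i x).hasFDerivAt).differentiableAt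

/-- Cramer's rule: each entry of the inverse is a quotient of determinants, which are polynomial in
the entries. -/
theorem differentiable_inv_apply {A : E → Matrix n n ℂ}
    (hA : ∀ i j, Differentiable ℝ fun x => A x i j) (h0 : ∀ x, (A x).det ≠ 0) (i j : n) :
    Differentiable ℝ fun x => (A x)⁻¹ i j := by
  simp only [Matrix.inv_def, Ring.inverse_eq_inv', Matrix.smul_apply, smul_eq_mul,
    Matrix.adjugate_apply]
  refine ((differentiable_det hA).fun_inv h0).fun_mul (differentiable_det fun a b => ?_)
  simp only [Matrix.updateRow_apply]
  split_ifs
  · exact differentiable_const _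
  · exact hA a b

end Diff

/-! ### The Karush-Kuhn-Tucker conditions -/

section KKT

variable {E : Type*} [NormedAddCommGroup E] [NormedSpace ℝ E] {ι : Type*} [Fintype ι]

/-- Multipliers from the Mangasarian-Fromovitz condition, for linear functionals. -/
theorem exists_multipliers (F : E →L[ℝ] ℝ) (G : ι → E →L[ℝ] ℝ)
    (hno : ∀ d, 0 < F d → ¬ ∀ i, G i d < 0) (d₀ : E) (hd₀ : ∀ i, G i d₀ < 0) :
    ∃ μ : ι → ℝ, (∀ i, 0 ≤ μ i) ∧ F = ∑ i, μ i • G i := by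
  classical
  -- The subspace of all vectors `(F d, -G d)`, with `none` indexing the objective. By `hno` it
  -- misses the open positive orthant `O`, so the two can be separated.
  let V : Set (Option ι → ℝ) := Set.range fun d : E => fun o : Option ι =>
    o.elim (F d) fun i => - G i d
  let O : Set (Option ι → ℝ) := Set.pi Set.univ fun _ => Set.Ioi 0
  have hO : Convex ℝ O := convex_pi fun _ _ => convex_Ioi 0
  have hOo : IsOpen O := isOpen_set_pi Set.finite_univ fun _ _ => isOpen_Ioi
  have hV : Convex ℝ V := by
    rintro _ ⟨d, rfl⟩ _ ⟨e, rfl⟩ a b - - -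
    refine ⟨a • d + b • e, ?_⟩
    ext o
    cases o <;> simp
    ring
  have hdisj : Disjoint O V := by
    rw [Set.disjoint_left]
    rintro _ hd ⟨d, rfl⟩
    refine hno d (hd none trivial) fun i => ?_
    have := hd (some i) trivial
    simpa using this
  obtain ⟨L, u, hL1, hL2⟩ := geometric_hahn_banach_open hO hOo hV hdisj
  let c : Option ι → ℝ := fun o => - L (Pi.single o 1)
  have hLc : ∀ y, L y = - ∑ o, y o * c o := by
    intro y
    conv_lhs => rw [← Finset.univ_sum_single y]
    rw [map_sum, ← Finset.sum_neg_distrib]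
    refine Finset.sum_congr rfl fun o _ => ?_
    have : (Pi.single o (y o) : Option ι → ℝ) = y o • Pi.single o 1 := by
      rw [← Pi.single_smul]; simp
    rw [this, map_smul]; simp [c]
  have hu0 : u ≤ 0 := by
    have := hL2 0 ⟨0, by ext o; cases o <;> simp⟩
    simpa using this
  -- A linear functional bounded below on a subspace vanishes there.
  have hLV : ∀ y ∈ V, L y = 0 := by
    have key : ∀ y ∈ V, 0 ≤ L y := by
      rintro _ ⟨d, rfl⟩
      by_contra hneg
      push Not at hneg
      set y : Option ι → ℝ := fun o => o.elim (F d) fun i => - G i d with hy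
      obtain ⟨t, ht⟩ : ∃ t : ℝ, t * L y < u := ⟨(u - 1) / L y, by
        rw [div_mul_cancel₀ _ hneg.ne]; linarith⟩
      have := hL2 (t • y) ⟨t • d, by ext o; cases o <;> simp [hy]⟩
      rw [map_smul, smul_eq_mul] at this
      linarith
    rintro y ⟨d, rfl⟩
    refine le_antisymm ?_ (key _ ⟨d, rfl⟩)
    have := key _ ⟨-d, rfl⟩
    rw [← neg_nonneg, ← map_neg]
    dsimp only at this ⊢
    have hneg : (-fun o : Option ι => o.elim (F d) fun i => -(G i) d) =
        fun o : Option ι => o.elim (F (-d)) fun i => -(G i) (-d) := by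
      ext o
      cases o <;> simp
    rwa [hneg]
  have hu : u = 0 := le_antisymm hu0 (by
    have hcl : L 0 ≤ u := by
      have h1 : Tendsto (fun t : ℝ => L (fun _ => t)) (𝓝[>] 0) (𝓝 (L 0)) :=
        (L.continuous.comp (continuous_pi fun _ => continuous_id)).continuousAt.tendsto.mono_left
          nhdsWithin_le_nhds
      refine le_of_tendsto h1 ?_
      filter_upwards [self_mem_nhdsWithin] with t ht
      exact (hL1 _ fun _ _ => ht).le
    simpa using hcl)
  subst hu
  -- A basis vector is the limit, as `t` decreases to `0`, of its translates by the constant `t`,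
  -- which lie in `O`, where `L` is negative.
  have hc : ∀ o, 0 ≤ c o := by
    intro o
    have h1 : Tendsto (fun t : ℝ => L (fun o' => t + (Pi.single o 1 : Option ι → ℝ) o')) (𝓝[>] 0)
        (𝓝 (L (fun o' => 0 + (Pi.single o 1 : Option ι → ℝ) o'))) :=
      (L.continuous.comp (continuous_pi fun _ => by fun_prop)).continuousAt.tendsto.mono_left
        nhdsWithin_le_nhds
    have h2 : L (fun o' => 0 + (Pi.single o 1 : Option ι → ℝ) o') ≤ 0 := by
      refine le_of_tendsto h1 ?_
      filter_upwards [self_mem_nhdsWithin] with t ht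
      refine (hL1 _ fun o' _ => ?_).le
      have h3 : (0 : ℝ) ≤ (Pi.single o 1 : Option ι → ℝ) o' := by
        by_cases h : o' = o
        · subst h; simp
        · simp [Pi.single_eq_of_ne h]
      exact add_pos_of_pos_of_nonneg ht h3
    have h4 : (fun o' => 0 + (Pi.single o 1 : Option ι → ℝ) o') = Pi.single o 1 := by
      ext; simp
    rw [h4] at h2
    simpa [c] using h2
  have hrel : ∀ d, c none * F d = ∑ i, c (some i) * G i d := by
    intro d
    have := hLV _ ⟨d, rfl⟩
    rw [hLc, Fintype.sum_option] at this
    simp only [Option.elim, neg_mul, Finset.sum_neg_distrib] at this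
    have h5 : ∑ i, c (some i) * G i d = ∑ i, G i d * c (some i) :=
      Finset.sum_congr rfl fun i _ => mul_comm _ _
    rw [h5]
    linarith
  -- Normality: if the objective had coefficient zero, evaluating at `d₀` would make every
  -- coefficient vanish, against `L < 0` on `O`.
  have hcn : 0 < c none := by
    refine lt_of_le_of_ne (hc none) fun h0 => ?_
    have h6 := hrel d₀
    rw [← h0, zero_mul] at h6
    have h7 : ∀ i, c (some i) = 0 := by
      have h8 : ∀ i ∈ Finset.univ, c (some i) * G i d₀ = 0 :=
        (Finset.sum_eq_zero_iff_of_nonpos fun i _ =>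
          mul_nonpos_of_nonneg_of_nonpos (hc _) (hd₀ i).le).1 h6.symm
      intro i
      exact (mul_eq_zero.1 (h8 i (Finset.mem_univ i))).resolve_right (hd₀ i).ne
    have h9 := hL1 (fun _ => 1) fun _ _ => one_pos (α := ℝ)
    rw [hLc, Fintype.sum_option, ← h0] at h9
    simp [h7] at h9
  refine ⟨fun i => c (some i) / c none, fun i => div_nonneg (hc _) hcn.le, ?_⟩
  ext d
  simp only [sum_apply, smul_apply, smul_eq_mul]
  have : ∑ i, c (some i) / c none * G i d = (∑ i, c (some i) * G i d) / c none := by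
    rw [Finset.sum_div]
    exact Finset.sum_congr rfl fun i _ => by ring
  rw [this, ← hrel]
  field_simp

/-- A feasible point at which the Mangasarian-Fromovitz condition holds and at which no direction
improves the objective to first order while decreasing all active constraints is a KKT point. -/
theorem isKKTPoint_of_no_ascent {f : E → ℝ} {g : ι → E → ℝ} {x : E} (hf : DifferentiableAt ℝ f x)
    (hg : ∀ i, DifferentiableAt ℝ (g i) x) (hx : ∀ i, g i x ≤ 0)
    (hno : ∀ d, 0 < fderiv ℝ f x d → ¬ ∀ i, g i x = 0 → fderiv ℝ (g i) x d < 0)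
    (d₀ : E) (hd₀ : ∀ i, g i x = 0 → fderiv ℝ (g i) x d₀ < 0) : IsKKTPoint f g x := by
  classical
  obtain ⟨μ, hμ, hF⟩ := exists_multipliers (fderiv ℝ f x)
    (fun i : {i // g i x = 0} => fderiv ℝ (g i) x)
    (fun d hd h => hno d hd fun i hi => h ⟨i, hi⟩) d₀ (fun i => hd₀ i i.2)
  refine ⟨hf, hg, hx, fun i => if h : g i x = 0 then μ ⟨i, h⟩ else 0, fun i => ?_, fun i => ?_, ?_⟩
  · dsimp only
    split_ifs
    · exact hμ _
    · exact le_rfl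
  · dsimp only
    split_ifs with h
    · rw [h, mul_zero]
    · rw [zero_mul]
  · rw [hF]
    set F : ι → E →L[ℝ] ℝ := fun i => (if h : g i x = 0 then μ ⟨i, h⟩ else 0) • fderiv ℝ (g i) x
    calc ∑ i, μ i • fderiv ℝ (g i) x = ∑ i : {i // g i x = 0}, F i :=
          Finset.sum_congr rfl fun i _ => by simp [F, i.2]
      _ = ∑ i ∈ Finset.univ.filter fun i => g i x = 0, F i :=
          (Finset.sum_subtype _ (by simp) F).symm
      _ = ∑ i, F i := Finset.sum_subset (Finset.subset_univ _) fun i _ hi => by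
          simp only [Finset.mem_filter, Finset.mem_univ, true_and] at hi
          simp [F, hi]

/-- An inactive constraint stays negative by continuity, an active one becomes negative because its
directional derivative is. -/
theorem eventually_neg_of_fderiv_neg {g : E → ℝ} {x d : E} (hg : DifferentiableAt ℝ g x)
    (hx : g x ≤ 0) (hd : g x = 0 → fderiv ℝ g x d < 0) :
    ∀ᶠ t : ℝ in 𝓝[>] 0, g (x + t • d) < 0 := by
  have hline : HasDerivAt (fun t : ℝ => x + t • d) d 0 := by
    simpa using ((hasDerivAt_id (0 : ℝ)).smul_const d).const_add x
  have hgd : HasDerivAt (fun t : ℝ => g (x + t • d)) (fderiv ℝ g x d) 0 := by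
    have h1 : HasFDerivAt g (fderiv ℝ g x) (x + (0 : ℝ) • d) := by simpa using hg.hasFDerivAt
    exact h1.comp_hasDerivAt (0 : ℝ) hline
  rcases hx.lt_or_eq with h | h
  · have h2 : Tendsto (fun t : ℝ => g (x + t • d)) (𝓝 0) (𝓝 (g x)) := by
      simpa using hgd.continuousAt.tendsto
    exact (h2.eventually (gt_mem_nhds h)).filter_mono nhdsWithin_le_nhds
  · have h3 := (hasDerivAt_iff_tendsto_slope.1 hgd).mono_left
      (nhdsWithin_mono (0 : ℝ) fun t ht => (ne_of_gt (Set.mem_Ioi.1 ht) : t ∈ ({0} : Set ℝ)ᶜ))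
    filter_upwards [h3.eventually (gt_mem_nhds (hd h)), self_mem_nhdsWithin] with t ht ht0
    have ht0 : 0 < t := ht0
    simp only [slope_def_field, zero_smul, add_zero, h, sub_zero] at ht
    exact (div_neg_iff.1 ht).elim (fun h => absurd ht0 (not_lt.2 h.2.le)) fun h => h.1

/-- The gradient inequality: slopes along the segment are at most the full chord. Only the segment
has to lie in `C`, so `x` may be a boundary point. -/
theorem fderiv_sub_le_of_convexOn {C : Set E} {g : E → ℝ} (hC : ConvexOn ℝ C g) {x y : E}
    (hx : x ∈ C) (hy : y ∈ C) (hg : DifferentiableAt ℝ g x) :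
    fderiv ℝ g x (y - x) ≤ g y - g x := by
  have hline : HasDerivAt (fun t : ℝ => x + t • (y - x)) (y - x) 0 := by
    simpa using ((hasDerivAt_id (0 : ℝ)).smul_const (y - x)).const_add x
  have hgd : HasDerivAt (fun t : ℝ => g (x + t • (y - x))) (fderiv ℝ g x (y - x)) 0 := by
    have h1 : HasFDerivAt g (fderiv ℝ g x) (x + (0 : ℝ) • (y - x)) := by simpa using hg.hasFDerivAt
    exact h1.comp_hasDerivAt (0 : ℝ) hline
  have h3 := (hasDerivAt_iff_tendsto_slope.1 hgd).mono_left
    (nhdsWithin_mono (0 : ℝ) fun t ht => (ne_of_gt (Set.mem_Ioi.1 ht) : t ∈ ({0} : Set ℝ)ᶜ))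
  refine le_of_tendsto h3 ?_
  filter_upwards [Ioo_mem_nhdsGT (zero_lt_one (α := ℝ))] with t ht
  simp only [slope_def_field, zero_smul, add_zero, sub_zero]
  rw [div_le_iff₀ ht.1]
  have h4 := hC.2 hx hy (sub_nonneg.2 ht.2.le) ht.1.le (by ring)
  have h5 : (1 - t) • x + t • y = x + t • (y - x) := by module
  rw [h5] at h4
  simp only [smul_eq_mul] at h4
  linarith

/-- Two differentiable functions that touch at `x`, one above the other, have the same derivative
there. -/
theorem fderiv_eq_of_touch {f g : E → ℝ} {x : E} (hf : DifferentiableAt ℝ f x)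
    (hg : DifferentiableAt ℝ g x) (hle : ∀ᶠ y in 𝓝 x, f y ≤ g y) (hx : f x = g x) :
    fderiv ℝ f x = fderiv ℝ g x := by
  have hmin : IsLocalMin (fun y => g y - f y) x := by
    filter_upwards [hle] with y hy
    rw [hx, sub_self]
    linarith
  have := hmin.fderiv_eq_zero
  rw [fderiv_fun_sub hg hf] at this
  exact (sub_eq_zero.1 this).symm

end KKT

/-- A sequence in a compact set all of whose cluster points lie in `T` approaches `T`. -/
theorem tendsto_infDist_of_mapClusterPt_mem {E : Type*} [PseudoMetricSpace E] {u : ℕ → E}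
    {C T : Set E} (hC : IsCompact C) (hu : ∀ᶠ n in atTop, u n ∈ C)
    (hT : ∀ z, MapClusterPt z atTop u → z ∈ T) :
    Tendsto (fun n => Metric.infDist (u n) T) atTop (𝓝 0) := by
  rw [Metric.tendsto_nhds]
  intro ε hε
  by_contra hcon
  rw [not_eventually] at hcon
  have hcon' : ∃ᶠ n in atTop, u n ∈ C ∩ {y | ε ≤ Metric.infDist y T} := by
    refine (hcon.and_eventually hu).mono fun n hn => ⟨hn.2, ?_⟩
    have h1 := hn.1
    rw [Real.dist_eq, sub_zero, abs_of_nonneg Metric.infDist_nonneg, not_lt] at h1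
    exact h1
  -- If the distance were at least `ε` infinitely often, compactness would give a cluster point at
  -- distance at least `ε` from `T`.
  have hC' : IsCompact (C ∩ {y | ε ≤ Metric.infDist y T}) :=
    hC.inter_right (isClosed_le continuous_const (Metric.continuous_infDist_pt T))
  obtain ⟨z, hz, hzc⟩ := hC'.exists_mapClusterPt_of_frequently hcon'
  have h2 := Metric.infDist_zero_of_mem (hT z hzc)
  have h3 : ε ≤ Metric.infDist z T := hz.2
  linarith

namespace System

variable {N K M : ℕ} (S : System N K M)

/-! ### Positive definiteness of the covariances -/

section Positivity

open scoped ComplexOrder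

theorem mul_vecMulVec_mul_conjTranspose (H : Matrix (Fin N) (Fin N) ℂ) (p : Fin N → ℂ) :
    H * Matrix.vecMulVec p (star p) * Hᴴ = Matrix.vecMulVec (H *ᵥ p) (star (H *ᵥ p)) := by
  rw [Matrix.mul_vecMulVec, Matrix.vecMulVec_mul, Matrix.star_mulVec]

theorem posDef_noise : (((S.σu ^ 2 : ℝ) : ℂ) • (1 : Matrix (Fin N) (Fin N) ℂ)).PosDef := by
  refine Matrix.PosDef.smul Matrix.PosDef.one ?_
  have := S.σu_pos
  exact Complex.zero_lt_real.2 (by positivity)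

theorem posDef_covC (p : Fin N → ℂ) : (S.covC p).PosDef := by
  unfold covC
  rw [mul_vecMulVec_mul_conjTranspose]
  exact posDef_vecMulVec_add S.posDef_noise _

theorem posSemidef_interference (k : Fin K) :
    (∑ i ∈ Finset.univ.filter (fun i => S.π k < S.π i),
      (S.Pu : ℂ) • Matrix.vecMulVec (S.hu i) (star (S.hu i))).PosSemidef :=
  Matrix.posSemidef_sum _ fun _ _ =>
    (Matrix.posSemidef_vecMulVec_self_star _).smul (Complex.zero_le_real.2 S.Pu_pos.le)

theorem posDef_covU (k : Fin K) (p : Fin N → ℂ) : (S.covU k p).PosDef := by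
  unfold covU
  rw [mul_vecMulVec_mul_conjTranspose, add_assoc]
  exact Matrix.PosDef.posSemidef_add (S.posSemidef_interference k)
    (posDef_vecMulVec_add S.posDef_noise _)

end Positivity

/-! ### Mean square errors and rates -/

/-- Absorbing `√Pu` into the channel puts the uplink streams in the form treated by
`quadMse_vecMulVec_add`. -/
theorem smul_vecMulVec_hu (k : Fin K) :
    (S.Pu : ℂ) • Matrix.vecMulVec (S.hu k) (star (S.hu k)) =
      Matrix.vecMulVec ((Real.sqrt S.Pu : ℂ) • S.hu k) (star ((Real.sqrt S.Pu : ℂ) • S.hu k)) := by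
  have h : (S.Pu : ℂ) = (Real.sqrt S.Pu : ℂ) * (Real.sqrt S.Pu : ℂ) := by
    rw [← Complex.ofReal_mul, Real.mul_self_sqrt S.Pu_pos.le]
  rw [star_smul, Matrix.smul_vecMulVec, Matrix.vecMulVec_smul, smul_smul, h]
  simp

theorem mseU_eq_quadMse (k : Fin K) (w p : Fin N → ℂ) :
    S.mseU k w p = quadMse
      (Matrix.vecMulVec ((Real.sqrt S.Pu : ℂ) • S.hu k) (star ((Real.sqrt S.Pu : ℂ) • S.hu k)) +
        S.covU k p) ((Real.sqrt S.Pu : ℂ) • S.hu k) w := by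
  rw [mseU, quadMse, smul_vecMulVec_hu, dotProduct_smul, smul_eq_mul]

theorem mseS_eq_quadMse (w p : Fin N → ℂ) :
    S.mseS w p = quadMse (Matrix.vecMulVec (S.Hs *ᵥ p) (star (S.Hs *ᵥ p)) + S.covC p)
      (S.Hs *ᵥ p) w := by
  rw [mseS, quadMse, mul_vecMulVec_mul_conjTranspose]

/-- Uplink SINR. -/
def sinrU (k : Fin K) (p : Fin N → ℂ) : ℝ :=
  S.Pu * (star (S.hu k) ⬝ᵥ ((S.covU k p)⁻¹ *ᵥ S.hu k)).re

theorem sinrU_eq (k : Fin K) (p : Fin N → ℂ) :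
    S.sinrU k p = (star ((Real.sqrt S.Pu : ℂ) • S.hu k) ⬝ᵥ
      ((S.covU k p)⁻¹ *ᵥ ((Real.sqrt S.Pu : ℂ) • S.hu k))).re := by
  have h : (S.Pu : ℂ) = (Real.sqrt S.Pu : ℂ) * (Real.sqrt S.Pu : ℂ) := by
    rw [← Complex.ofReal_mul, Real.mul_self_sqrt S.Pu_pos.le]
  rw [sinrU, ← Complex.re_ofReal_mul, h, star_smul, Matrix.mulVec_smul, smul_dotProduct,
    dotProduct_smul, smul_eq_mul, smul_eq_mul, ← mul_assoc]
  simp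

theorem sinrU_nonneg (k : Fin K) (p : Fin N → ℂ) : 0 ≤ S.sinrU k p :=
  mul_nonneg S.Pu_pos.le (dotProduct_inv_mulVec_nonneg (S.posDef_covU k p) _)

theorem sinrS_nonneg (p : Fin N → ℂ) : 0 ≤ S.sinrS p :=
  dotProduct_inv_mulVec_nonneg (S.posDef_covC p) _

/-- SNR at the CS. -/
def snrD (p : Fin N → ℂ) : ℝ := ‖star S.hd ⬝ᵥ p‖ ^ 2 / S.σd ^ 2

theorem snrD_nonneg (p : Fin N → ℂ) : 0 ≤ S.snrD p := by unfold snrD; positivity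

theorem le_mseU (k : Fin K) (w p : Fin N → ℂ) : (1 + S.sinrU k p)⁻¹ ≤ S.mseU k w p := by
  rw [mseU_eq_quadMse, sinrU_eq]
  exact (quadMse_vecMulVec_add (S.posDef_covU k p) _ w).1

theorem mseU_recU (k : Fin K) (p : Fin N → ℂ) :
    S.mseU k (S.recU k p) p = (1 + S.sinrU k p)⁻¹ := by
  rw [mseU_eq_quadMse, sinrU_eq, recU, ← Matrix.mulVec_smul, smul_vecMulVec_hu]
  exact (quadMse_vecMulVec_add (S.posDef_covU k p) _ 0).2

theorem le_mseS (w p : Fin N → ℂ) : (1 + S.sinrS p)⁻¹ ≤ S.mseS w p := by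
  rw [mseS_eq_quadMse]
  exact (quadMse_vecMulVec_add (S.posDef_covC p) _ w).1

theorem mseS_recS (p : Fin N → ℂ) : S.mseS (S.recS p) p = (1 + S.sinrS p)⁻¹ := by
  rw [mseS_eq_quadMse, recS, mul_vecMulVec_mul_conjTranspose]
  exact (quadMse_vecMulVec_add (S.posDef_covC p) _ 0).2

theorem normSq_add_pos (p : Fin N → ℂ) : 0 < ‖star S.hd ⬝ᵥ p‖ ^ 2 + S.σd ^ 2 := by
  have := S.σd_pos
  positivity

/-- The scalar completed square, giving both the lower bound and its attainment at `recD`. -/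
theorem mseD_eq (w : ℂ) (p : Fin N → ℂ) :
    S.mseD w p = (‖star S.hd ⬝ᵥ p‖ ^ 2 + S.σd ^ 2) * ‖w - S.recD p‖ ^ 2 + (1 + S.snrD p)⁻¹ := by
  have hσ := S.σd_pos
  have hA := S.normSq_add_pos p
  set a := star S.hd ⬝ᵥ p with ha
  have h1 : (1 + S.snrD p)⁻¹ = 1 - ‖a‖ ^ 2 / (‖a‖ ^ 2 + S.σd ^ 2) := by
    rw [snrD, ← ha]
    field_simp
    ring
  have h2 : S.recD p = (((‖a‖ ^ 2 + S.σd ^ 2)⁻¹ : ℝ) : ℂ) * a := by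
    rw [recD, ← ha, Complex.ofReal_inv]
  rw [h1, h2, mseD, ← ha]
  set A := ‖a‖ ^ 2 + S.σd ^ 2 with hAdef
  have h3 : ‖a‖ ^ 2 = a.re ^ 2 + a.im ^ 2 := by
    rw [Complex.sq_norm, Complex.normSq_apply]; ring
  rw [h3]
  simp only [Complex.sq_norm, Complex.normSq_apply, Complex.sub_re, Complex.sub_im, Complex.mul_re,
    Complex.mul_im, Complex.ofReal_re, Complex.ofReal_im, Complex.star_def, Complex.conj_re,
    Complex.conj_im]
  field_simp
  ring

theorem le_mseD (w : ℂ) (p : Fin N → ℂ) : (1 + S.snrD p)⁻¹ ≤ S.mseD w p := by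
  rw [mseD_eq]
  have := S.normSq_add_pos p
  have : 0 ≤ (‖star S.hd ⬝ᵥ p‖ ^ 2 + S.σd ^ 2) * ‖w - S.recD p‖ ^ 2 := by positivity
  linarith

theorem mseD_recD (p : Fin N → ℂ) : S.mseD (S.recD p) p = (1 + S.snrD p)⁻¹ := by
  rw [mseD_eq]
  simp

theorem _root_.JCSMC.cst_sub_awmse_le_logb {ϖ e γ : ℝ} (hϖ : 0 < ϖ) (hγ : 0 ≤ γ)
    (he : (1 + γ)⁻¹ ≤ e) : cst - awmse ϖ e ≤ Real.logb 2 (1 + γ) := by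
  have h0 : 0 < (1 + γ)⁻¹ := by positivity
  have h1 := cst_sub_awmse_le hϖ h0
  rw [Real.logb_inv, neg_neg] at h1
  have := awmse_mono hϖ.le he
  linarith

theorem _root_.JCSMC.cst_sub_awmse_eq_logb {γ : ℝ} (hγ : 0 ≤ γ) :
    cst - awmse (((1 + γ)⁻¹ * Real.log 2)⁻¹) (1 + γ)⁻¹ = Real.logb 2 (1 + γ) := by
  rw [cst_sub_awmse_eq (by positivity), Real.logb_inv, neg_neg]

/-- The weights are positive. -/
def WeightsPos (ϖ : Weights K) : Prop := (∀ k, 0 < ϖ.1 k) ∧ 0 < ϖ.2.1 ∧ 0 < ϖ.2.2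

theorem weightsPos_mmseWeights (p : Fin N → ℂ) : WeightsPos (S.mmseWeights p) := by
  have hl : 0 < Real.log 2 := Real.log_pos one_lt_two
  refine ⟨fun k => ?_, ?_, ?_⟩
  · have := S.sinrU_nonneg k p
    simp only [mmseWeights, mseU_recU]
    positivity
  · have := S.sinrS_nonneg p
    simp only [mmseWeights, mseS_recS]
    positivity
  · have := S.snrD_nonneg p
    simp only [mmseWeights, mseD_recD]
    positivity

theorem constraintOf_mono {Ru Ru' : Fin K → ℝ} {Rd Rd' Rs Rs' : ℝ} (hu : ∀ k, Ru' k ≤ Ru k)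
    (hd : Rd' ≤ Rd) (hs : Rs' ≤ Rs) (x : Alloc N K) (i : Con K) :
    S.constraintOf Ru Rd Rs x i ≤ S.constraintOf Ru' Rd' Rs' x i := by
  have hB := S.B_pos.le
  cases i with
  | uplink k => exact sub_le_sub_left (mul_le_mul_of_nonneg_left (hu k) hB) _
  | downlink => exact sub_le_sub_left (mul_le_mul_of_nonneg_left hd hB) _
  | sensing => exact sub_le_sub_left hs _
  | power => exact le_rfl
  | nonnegB k => exact le_rfl
  | nonnegC k => exact le_rfl

/-- Rates enter the constraints with a negative sign, so minorants of the rates give majorants of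
the constraints. -/
theorem conRate_le_conMSE (i : Con K) {z : Point N K} (hz : WeightsPos z.1) :
    S.conRate i z.2.2 ≤ S.conMSE i z :=
  S.constraintOf_mono
    (fun k => cst_sub_awmse_le_logb (hz.1 k) (S.sinrU_nonneg k _) (S.le_mseU k _ _))
    (cst_sub_awmse_le_logb hz.2.2 (S.snrD_nonneg _) (S.le_mseD _ _))
    (cst_sub_awmse_le_logb hz.2.1 (S.sinrS_nonneg _) (S.le_mseS _ _)) _ i

/-- At the MMSE weights and receivers, the lower bounds of the rates are exact. -/
theorem conMSE_mmse (i : Con K) (x : Alloc N K) :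
    S.conMSE i (S.mmseWeights x.2.2, S.mmseReceivers x.2.2, x) = S.conRate i x := by
  unfold conMSE conRate
  simp only [mmseWeights, mmseReceivers, mseU_recU, mseD_recD, mseS_recS]
  rw [cst_sub_awmse_eq_logb (S.snrD_nonneg _), cst_sub_awmse_eq_logb (S.sinrS_nonneg _)]
  have h : (fun k => cst - awmse (((1 + S.sinrU k x.2.2)⁻¹ * Real.log 2)⁻¹)
      (1 + S.sinrU k x.2.2)⁻¹) = fun k => S.rateU k x.2.2 :=
    funext fun k => cst_sub_awmse_eq_logb (S.sinrU_nonneg _ _)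
  rw [h]
  rfl

variable {S} in
theorem IsMMSE.eq {z : Point N K} (hz : S.IsMMSE z) :
    z = (S.mmseWeights z.2.2.2.2, S.mmseReceivers z.2.2.2.2, z.2.2) :=
  Prod.ext hz.1 (Prod.ext hz.2 rfl)

variable {S} in
theorem IsMMSE.weightsPos {z : Point N K} (hz : S.IsMMSE z) : WeightsPos z.1 := by
  rw [hz.1]
  exact S.weightsPos_mmseWeights _

variable {S} in
theorem IsMMSE.conMSE_eq {z : Point N K} (hz : S.IsMMSE z) (i : Con K) :
    S.conMSE i z = S.conRate i z.2.2 := by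
  rw [hz.eq]
  exact S.conMSE_mmse i _

/-! ### Differentiability -/

section Diff

theorem differentiable_vecMulVec_apply {E : Type*} [NormedAddCommGroup E] [NormedSpace ℝ E]
    {v : E → Fin N → ℂ} (hv : Differentiable ℝ v) (i j : Fin N) :
    Differentiable ℝ fun x => Matrix.vecMulVec (v x) (star (v x)) i j := by
  simp only [Matrix.vecMulVec_apply]
  exact (differentiable_pi.1 hv i).fun_mul (differentiable_pi.1 (differentiable_star hv) j)

theorem differentiable_covU_apply (k : Fin K) (i j : Fin N) :
    Differentiable ℝ fun p => S.covU k p i j := by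
  simp only [covU, mul_vecMulVec_mul_conjTranspose, Matrix.add_apply]
  exact ((differentiable_const _).fun_add (differentiable_vecMulVec_apply
    (differentiable_const_mulVec _ differentiable_id) i j)).fun_add (differentiable_const _)

theorem differentiable_covC_apply (i j : Fin N) :
    Differentiable ℝ fun p => S.covC p i j := by
  simp only [covC, mul_vecMulVec_mul_conjTranspose, Matrix.add_apply]
  exact (differentiable_vecMulVec_apply
    (differentiable_const_mulVec _ differentiable_id) i j).fun_add (differentiable_const _)

open scoped ComplexOrder in
theorem _root_.JCSMC.det_ne_zero_of_posDef {R : Matrix (Fin N) (Fin N) ℂ} (hR : R.PosDef) :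
    R.det ≠ 0 := hR.det_pos.ne'

theorem differentiable_sinrU (k : Fin K) : Differentiable ℝ (S.sinrU k) := by
  unfold sinrU
  refine (differentiable_re (differentiable_dotProduct (differentiable_const _)
    (differentiable_mulVec (fun i j => ?_) (differentiable_const _)))).const_mul _
  exact differentiable_inv_apply (S.differentiable_covU_apply k)
    (fun p => det_ne_zero_of_posDef (S.posDef_covU k p)) i j

theorem differentiable_sinrS : Differentiable ℝ S.sinrS := by
  unfold sinrS
  have hv : Differentiable ℝ fun p => S.Hs *ᵥ p := differentiable_const_mulVec _ differentiable_id
  refine differentiable_re (differentiable_dotProduct (differentiable_star hv)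
    (differentiable_mulVec (fun i j => ?_) hv))
  exact differentiable_inv_apply S.differentiable_covC_apply
    (fun p => det_ne_zero_of_posDef (S.posDef_covC p)) i j

theorem _root_.JCSMC.differentiable_norm_sq {E : Type*} [NormedAddCommGroup E] [NormedSpace ℝ E]
    {f : E → ℂ} (hf : Differentiable ℝ f) : Differentiable ℝ fun x => ‖f x‖ ^ 2 :=
  hf.norm_sq ℝ

theorem differentiable_hd_dotProduct :
    Differentiable ℝ fun p : Fin N → ℂ => star S.hd ⬝ᵥ p :=
  differentiable_dotProduct (differentiable_const _) differentiable_id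

theorem differentiable_snrD : Differentiable ℝ S.snrD := by
  unfold snrD
  simp only [div_eq_mul_inv]
  exact (differentiable_norm_sq S.differentiable_hd_dotProduct).mul_const _

theorem _root_.JCSMC.differentiable_logb_one_add {E : Type*} [NormedAddCommGroup E]
    [NormedSpace ℝ E] {f : E → ℝ} (hf : Differentiable ℝ f) (h0 : ∀ x, 0 ≤ f x) :
    Differentiable ℝ fun x => Real.logb 2 (1 + f x) := by
  simp only [Real.logb, div_eq_mul_inv]
  exact ((hf.const_add 1).log fun x => (by linarith [h0 x] : 0 < 1 + f x).ne').mul_const _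

theorem differentiable_rateU (k : Fin K) : Differentiable ℝ (S.rateU k) :=
  differentiable_logb_one_add (S.differentiable_sinrU k) (S.sinrU_nonneg k)

theorem differentiable_rateD : Differentiable ℝ S.rateD :=
  differentiable_logb_one_add S.differentiable_snrD S.snrD_nonneg

theorem differentiable_rateS : Differentiable ℝ S.rateS :=
  differentiable_logb_one_add S.differentiable_sinrS S.sinrS_nonneg

theorem differentiableAt_constraintOf {E : Type*} [NormedAddCommGroup E] [NormedSpace ℝ E]
    {Ru : E → Fin K → ℝ} {Rd Rs : E → ℝ} {x : E → Alloc N K} {e : E}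
    (hu : ∀ k, DifferentiableAt ℝ (fun e => Ru e k) e)
    (hd : DifferentiableAt ℝ Rd e) (hs : DifferentiableAt ℝ Rs e) (hx : DifferentiableAt ℝ x e)
    (i : Con K) :
    DifferentiableAt ℝ (fun e => S.constraintOf (Ru e) (Rd e) (Rs e) (x e) i) e := by
  have hb : ∀ k, DifferentiableAt ℝ (fun e => (x e).1 k) e := differentiableAt_pi.1 hx.fst
  have hc : ∀ k, DifferentiableAt ℝ (fun e => (x e).2.1 k) e := differentiableAt_pi.1 hx.snd.fst
  have hp : ∀ n, DifferentiableAt ℝ (fun e => (x e).2.2 n) e := differentiableAt_pi.1 hx.snd.snd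
  cases i with
  | uplink k => exact ((hb k).fun_add (hc k)).fun_sub ((hu k).const_mul _)
  | downlink => exact (DifferentiableAt.fun_sum fun k _ => hc k).fun_sub (hd.const_mul _)
  | sensing => exact (differentiableAt_const _).fun_sub hs
  | power =>
    exact (((DifferentiableAt.fun_sum fun k _ =>
      (((hb k).const_mul _).fun_pow 3).const_mul _)).fun_add
      (DifferentiableAt.fun_sum fun n _ => (hp n).norm_sq ℝ)).fun_sub (differentiableAt_const _)
  | nonnegB k => exact (hb k).fun_neg
  | nonnegC k => exact (hc k).fun_neg

theorem differentiable_conRate (i : Con K) : Differentiable ℝ (S.conRate i) := fun x =>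
  S.differentiableAt_constraintOf (x := fun x => x)
    (fun k => (S.differentiable_rateU k _).comp x differentiableAt_id.snd.snd)
    ((S.differentiable_rateD _).comp x differentiableAt_id.snd.snd)
    ((S.differentiable_rateS _).comp x differentiableAt_id.snd.snd) differentiableAt_id i

theorem differentiable_quadMse {E : Type*} [NormedAddCommGroup E] [NormedSpace ℝ E]
    {A : E → Matrix (Fin N) (Fin N) ℂ} {h w : E → Fin N → ℂ}
    (hA : ∀ i j, Differentiable ℝ fun x => A x i j) (hh : Differentiable ℝ h)
    (hw : Differentiable ℝ w) : Differentiable ℝ fun x => quadMse (A x) (h x) (w x) := by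
  unfold quadMse
  have hw' := differentiable_star hw
  exact ((differentiable_re (differentiable_dotProduct hw'
    (differentiable_mulVec hA hw))).fun_sub
    ((differentiable_re (differentiable_dotProduct hw' hh)).const_mul 2)).add_const 1

theorem differentiable_mseU (k : Fin K) :
    Differentiable ℝ fun q : (Fin N → ℂ) × (Fin N → ℂ) => S.mseU k q.1 q.2 := by
  simp only [mseU_eq_quadMse]
  refine differentiable_quadMse (fun i j => ?_) (differentiable_const _) differentiable_fst
  simp only [Matrix.add_apply]
  exact (differentiable_const _).fun_add
    ((S.differentiable_covU_apply k i j).comp differentiable_snd)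

theorem differentiable_mseS :
    Differentiable ℝ fun q : (Fin N → ℂ) × (Fin N → ℂ) => S.mseS q.1 q.2 := by
  simp only [mseS_eq_quadMse]
  have hv : Differentiable ℝ fun q : (Fin N → ℂ) × (Fin N → ℂ) => S.Hs *ᵥ q.2 :=
    differentiable_const_mulVec _ differentiable_snd
  refine differentiable_quadMse (fun i j => ?_) hv differentiable_fst
  simp only [Matrix.add_apply]
  exact (differentiable_vecMulVec_apply hv i j).fun_add
    ((S.differentiable_covC_apply i j).comp differentiable_snd)

theorem differentiable_mseD :
    Differentiable ℝ fun q : ℂ × (Fin N → ℂ) => S.mseD q.1 q.2 := by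
  unfold mseD
  have hv : Differentiable ℝ fun q : ℂ × (Fin N → ℂ) => star S.hd ⬝ᵥ q.2 :=
    S.differentiable_hd_dotProduct.comp differentiable_snd
  have hw : Differentiable ℝ fun q : ℂ × (Fin N → ℂ) => star q.1 :=
    Complex.conjCLE.differentiable.comp differentiable_fst
  exact (((differentiable_norm_sq differentiable_fst).fun_mul
    ((differentiable_norm_sq hv).add_const _)).fun_sub
    ((differentiable_re (hw.fun_mul hv)).const_mul 2)).add_const 1

section Comp

variable {E : Type*} [NormedAddCommGroup E] [NormedSpace ℝ E] {p : E → Fin N → ℂ} {e : E}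

theorem differentiableAt_mseU (k : Fin K) {w : E → Fin N → ℂ} (hw : DifferentiableAt ℝ w e)
    (hp : DifferentiableAt ℝ p e) : DifferentiableAt ℝ (fun e => S.mseU k (w e) (p e)) e := by
  have h := ((S.differentiable_mseU k) (w e, p e)).comp e (hw.prodMk hp)
  simpa only [Function.comp_def] using h

theorem differentiableAt_mseS {w : E → Fin N → ℂ} (hw : DifferentiableAt ℝ w e)
    (hp : DifferentiableAt ℝ p e) : DifferentiableAt ℝ (fun e => S.mseS (w e) (p e)) e := by
  have h := ((S.differentiable_mseS) (w e, p e)).comp e (hw.prodMk hp)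
  simpa only [Function.comp_def] using h

theorem differentiableAt_mseD {w : E → ℂ} (hw : DifferentiableAt ℝ w e)
    (hp : DifferentiableAt ℝ p e) : DifferentiableAt ℝ (fun e => S.mseD (w e) (p e)) e := by
  have h := ((S.differentiable_mseD) (w e, p e)).comp e (hw.prodMk hp)
  simpa only [Function.comp_def] using h

end Comp

theorem _root_.JCSMC.differentiableAt_cst_sub_awmse {E : Type*} [NormedAddCommGroup E]
    [NormedSpace ℝ E] {ϖ e : E → ℝ} {x : E} (hϖ : DifferentiableAt ℝ ϖ x)
    (he : DifferentiableAt ℝ e x) (h0 : ϖ x ≠ 0) :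
    DifferentiableAt ℝ (fun x => cst - awmse (ϖ x) (e x)) x := by
  simp only [awmse, Real.logb, div_eq_mul_inv]
  exact ((hϖ.fun_mul he).fun_sub ((hϖ.log h0).mul_const _)).const_sub _

theorem differentiableAt_conMSE (i : Con K) {z : Point N K} (hz : WeightsPos z.1) :
    DifferentiableAt ℝ (S.conMSE i) z := by
  have h1 : DifferentiableAt ℝ (fun z : Point N K => z) z := differentiableAt_id
  have hp := h1.snd.snd.snd.snd
  have hu : ∀ k, DifferentiableAt ℝ (fun z : Point N K =>
      cst - awmse (z.1.1 k) (S.mseU k (z.2.1.1 k) z.2.2.2.2)) z := fun k =>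
    differentiableAt_cst_sub_awmse (differentiableAt_pi.1 h1.fst.fst k)
      (S.differentiableAt_mseU k (differentiableAt_pi.1 h1.snd.fst.fst k) hp) (hz.1 k).ne'
  have hd : DifferentiableAt ℝ (fun z : Point N K =>
      cst - awmse z.1.2.2 (S.mseD z.2.1.2.2 z.2.2.2.2)) z :=
    differentiableAt_cst_sub_awmse h1.fst.snd.snd
      (S.differentiableAt_mseD h1.snd.fst.snd.snd hp) hz.2.2.ne'
  have hs : DifferentiableAt ℝ (fun z : Point N K =>
      cst - awmse z.1.2.1 (S.mseS z.2.1.2.1 z.2.2.2.2)) z :=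
    differentiableAt_cst_sub_awmse h1.fst.snd.fst
      (S.differentiableAt_mseS h1.snd.fst.snd.fst hp) hz.2.1.ne'
  exact S.differentiableAt_constraintOf hu hd hs h1.snd.snd i

theorem differentiable_recU (k : Fin K) : Differentiable ℝ (S.recU k) := by
  unfold recU
  suffices h : Differentiable ℝ fun p => ((S.Pu : ℂ) • Matrix.vecMulVec (S.hu k) (star (S.hu k)) +
      S.covU k p)⁻¹ *ᵥ S.hu k from h.fun_const_smul _
  refine differentiable_mulVec (fun i j => ?_) (differentiable_const _)
  refine differentiable_inv_apply (fun i j => ?_) (fun p => ?_) i j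
  · simp only [Matrix.add_apply]
    exact (differentiable_const _).fun_add (S.differentiable_covU_apply k i j)
  · rw [smul_vecMulVec_hu]
    exact det_ne_zero_of_posDef (posDef_vecMulVec_add (S.posDef_covU k p) _)

theorem differentiable_recS : Differentiable ℝ S.recS := by
  unfold recS
  simp only [mul_vecMulVec_mul_conjTranspose]
  have hv : Differentiable ℝ fun p => S.Hs *ᵥ p := differentiable_const_mulVec _ differentiable_id
  refine differentiable_mulVec (fun i j => ?_) hv
  refine differentiable_inv_apply (fun i j => ?_) (fun p => ?_) i j
  · simp only [Matrix.add_apply]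
    exact (differentiable_vecMulVec_apply hv i j).fun_add (S.differentiable_covC_apply i j)
  · exact det_ne_zero_of_posDef (posDef_vecMulVec_add (S.posDef_covC p) _)

theorem differentiable_recD : Differentiable ℝ S.recD := by
  unfold recD
  refine Differentiable.fun_mul (Differentiable.fun_inv ?_ fun p => ?_)
    S.differentiable_hd_dotProduct
  · exact Complex.ofRealCLM.differentiable.comp
      ((differentiable_norm_sq S.differentiable_hd_dotProduct).add_const _)
  · exact Complex.ofReal_ne_zero.2 (S.normSq_add_pos p).ne'

theorem continuous_mmseReceivers : Continuous S.mmseReceivers :=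
  (continuous_pi fun k => (S.differentiable_recU k).continuous).prodMk
    (S.differentiable_recS.continuous.prodMk S.differentiable_recD.continuous)

theorem continuous_mmseWeights : Continuous S.mmseWeights := by
  have hl : 0 < Real.log 2 := Real.log_pos one_lt_two
  unfold mmseWeights
  simp only [mseU_recU, mseS_recS, mseD_recD, mul_inv, inv_inv]
  exact (continuous_pi fun k =>
    ((S.differentiable_sinrU k).continuous.const_add 1).mul_const _).prodMk
    (((S.differentiable_sinrS.continuous.const_add 1).mul_const _).prodMk
    ((S.differentiable_snrD.continuous.const_add 1).mul_const _))

theorem differentiable_objective : Differentiable ℝ (S.objective) := by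
  unfold objective
  have h1 : Differentiable ℝ (fun x : Alloc N K => x) := differentiable_id
  exact Differentiable.fun_sum fun k _ => ((differentiable_pi.1 h1.fst k).fun_add
    (differentiable_pi.1 h1.snd.fst k)).const_mul _

end Diff


/-! ### Convexity -/

theorem _root_.JCSMC.re_dotProduct_vecMulVec_mulVec (v w : Fin N → ℂ) :
    (star w ⬝ᵥ (Matrix.vecMulVec v (star v) *ᵥ w)).re = ‖star w ⬝ᵥ v‖ ^ 2 := by
  have h : star v ⬝ᵥ w = star (star w ⬝ᵥ v) := Matrix.star_dotProduct v w
  rw [Matrix.vecMulVec_mulVec, dotProduct_smul, h, Complex.sq_norm, Complex.star_def]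
  simp [Complex.normSq_apply]

/-- The real linear map `p ↦ uᵀ H p`. -/
def _root_.JCSMC.dotMulVec (u : Fin N → ℂ) (H : Matrix (Fin N) (Fin N) ℂ) :
    (Fin N → ℂ) →ₗ[ℝ] ℂ where
  toFun p := u ⬝ᵥ (H *ᵥ p)
  map_add' p q := by rw [Matrix.mulVec_add, dotProduct_add]
  map_smul' c p := by
    rw [Matrix.mulVec_smul, dotProduct_smul]
    rfl

theorem _root_.JCSMC.convexOn_norm_sq_linear {E : Type*} [AddCommGroup E] [Module ℝ E]
    (L : E →ₗ[ℝ] ℂ) : ConvexOn ℝ Set.univ fun p => ‖L p‖ ^ 2 :=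
  ((convexOn_univ_norm (E := ℂ)).comp_linearMap L).pow (fun _ _ => norm_nonneg _) 2

/-- For a fixed receiver, `p` enters only through `|wᴴ H p|²`, the squared modulus of a linear form.
-/
theorem convexOn_mseU (k : Fin K) (w : Fin N → ℂ) : ConvexOn ℝ Set.univ (S.mseU k w) := by
  have h := (convexOn_norm_sq_linear (dotMulVec (star w) (S.Hs + S.Hc))).add_const
    ((star w ⬝ᵥ (((S.Pu : ℂ) • Matrix.vecMulVec (S.hu k) (star (S.hu k)) +
      (∑ i ∈ Finset.univ.filter (fun i => S.π k < S.π i),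
        (S.Pu : ℂ) • Matrix.vecMulVec (S.hu i) (star (S.hu i))) +
      ((S.σu ^ 2 : ℝ) : ℂ) • (1 : Matrix (Fin N) (Fin N) ℂ)) *ᵥ w)).re
      - 2 * ((Real.sqrt S.Pu : ℂ) * (star w ⬝ᵥ S.hu k)).re + 1)
  refine h.congr fun p _ => ?_
  simp only [mseU, covU, mul_vecMulVec_mul_conjTranspose, Matrix.add_mulVec, dotProduct_add,
    Complex.add_re, re_dotProduct_vecMulVec_mulVec]
  simp only [dotMulVec, LinearMap.coe_mk, AddHom.coe_mk, Matrix.add_mulVec, Pi.add_apply, dotProduct_add]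
  ring

theorem convexOn_mseS (w : Fin N → ℂ) : ConvexOn ℝ Set.univ (S.mseS w) := by
  have h := (((convexOn_norm_sq_linear (dotMulVec (star w) S.Hs)).add
    (convexOn_norm_sq_linear (dotMulVec (star w) S.Hc))).add
    ((((-2 : ℝ) • (Complex.reLm.comp (dotMulVec (star w) S.Hs))).convexOn
      (convex_univ)))).add_const
    ((star w ⬝ᵥ ((((S.σu ^ 2 : ℝ) : ℂ) • (1 : Matrix (Fin N) (Fin N) ℂ)) *ᵥ w)).re + 1)
  refine h.congr fun p _ => ?_
  simp only [mseS, covC, mul_vecMulVec_mul_conjTranspose, Matrix.add_mulVec, dotProduct_add,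
    Complex.add_re, re_dotProduct_vecMulVec_mulVec]
  simp [dotMulVec]
  ring

theorem convexOn_mseD (w : ℂ) : ConvexOn ℝ Set.univ (S.mseD w) := by
  have h := ((((convexOn_norm_sq_linear (dotMulVec (star S.hd) 1)).smul (sq_nonneg ‖w‖))).add
    (((-2 : ℝ) • (Complex.reLm.comp (dotMulVec (star w • star S.hd) 1))).convexOn
      convex_univ)).add_const (‖w‖ ^ 2 * S.σd ^ 2 + 1)
  refine h.congr fun p _ => ?_
  simp [dotMulVec, mseD]
  ring

/-- The allocations with nonnegative rates at the base station, on which the constraints of the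
subproblems are convex. -/
def nonnegRates (N K : ℕ) : Set (Alloc N K) := {x | ∀ k, 0 ≤ x.1 k}

theorem convex_nonnegRates : Convex ℝ (nonnegRates N K) := by
  intro x hx y hy a b ha hb _ k
  exact add_nonneg (mul_nonneg ha (hx k)) (mul_nonneg hb (hy k))

theorem convexOn_conMSE {ϖ : Weights K} (hϖ : WeightsPos ϖ) (w : Receivers N K) (i : Con K) :
    ConvexOn ℝ (nonnegRates N K) fun x => S.conMSE i (ϖ, w, x) := by
  refine ⟨convex_nonnegRates, fun x hx y hy a b ha hb hab => ?_⟩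
  have hB := S.B_pos.le
  obtain rfl : b = 1 - a := by linarith
  cases i with
  | uplink k =>
    have h := mul_le_mul_of_nonneg_left
      ((S.convexOn_mseU k (w.1 k)).2 (Set.mem_univ x.2.2) (Set.mem_univ y.2.2) ha hb hab)
      (mul_nonneg hB (hϖ.1 k).le)
    simp only [conMSE, constraintOf, awmse, Prod.fst_add, Prod.snd_add, Prod.smul_fst,
      Prod.smul_snd, Pi.add_apply, Pi.smul_apply, smul_eq_mul] at h ⊢
    linear_combination h
  | downlink =>
    have h := mul_le_mul_of_nonneg_left
      ((S.convexOn_mseD w.2.2).2 (Set.mem_univ x.2.2) (Set.mem_univ y.2.2) ha hb hab)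
      (mul_nonneg hB hϖ.2.2.le)
    simp only [conMSE, constraintOf, awmse, Prod.fst_add, Prod.snd_add, Prod.smul_fst,
      Prod.smul_snd, Pi.add_apply, Pi.smul_apply, smul_eq_mul, Finset.sum_add_distrib,
      ← Finset.mul_sum] at h ⊢
    linear_combination h
  | sensing =>
    have h := mul_le_mul_of_nonneg_left
      ((S.convexOn_mseS w.2.1).2 (Set.mem_univ x.2.2) (Set.mem_univ y.2.2) ha hb hab)
      hϖ.2.1.le
    simp only [conMSE, constraintOf, awmse, Prod.snd_add, Prod.smul_snd, smul_eq_mul] at h ⊢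
    linear_combination h
  | power =>
    -- The cube is convex only on the nonnegative half-line; this is where `nonnegRates` is needed.
    have h1 : ∀ k, S.κ * (S.φ * (a * x.1 k + (1 - a) * y.1 k)) ^ 3 ≤
        a * (S.κ * (S.φ * x.1 k) ^ 3) + (1 - a) * (S.κ * (S.φ * y.1 k) ^ 3) := by
      intro k
      have h := mul_le_mul_of_nonneg_left ((convexOn_pow 3).2 (Set.mem_Ici.2 (hx k))
        (Set.mem_Ici.2 (hy k)) ha hb hab) (mul_nonneg S.κ_pos.le (pow_nonneg S.φ_pos.le 3))
      simp only [smul_eq_mul] at h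
      linear_combination h
    have h2 : ∀ n, ‖(a • x.2.2 + (1 - a) • y.2.2) n‖ ^ 2 ≤
        a * ‖x.2.2 n‖ ^ 2 + (1 - a) * ‖y.2.2 n‖ ^ 2 := fun n =>
      (convexOn_norm_sq_linear (LinearMap.proj n : (Fin N → ℂ) →ₗ[ℝ] ℂ)).2
        (Set.mem_univ x.2.2) (Set.mem_univ y.2.2) ha hb hab
    have h3 := add_le_add (Finset.sum_le_sum fun k (_ : k ∈ Finset.univ) => h1 k)
      (Finset.sum_le_sum fun n (_ : n ∈ Finset.univ) => h2 n)
    simp only [Finset.sum_add_distrib, ← Finset.mul_sum] at h3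
    simp only [conMSE, constraintOf, Prod.fst_add, Prod.snd_add, Prod.smul_fst,
      Prod.smul_snd, Pi.add_apply, Pi.smul_apply, smul_eq_mul, ← Finset.mul_sum] at h3 ⊢
    linear_combination h3
  | nonnegB k =>
    simp only [conMSE, constraintOf, Prod.fst_add, Prod.smul_fst, Pi.add_apply, Pi.smul_apply,
      smul_eq_mul]
    linarith
  | nonnegC k =>
    simp only [conMSE, constraintOf, Prod.fst_add, Prod.snd_add, Prod.smul_fst,
      Prod.smul_snd, Pi.add_apply, Pi.smul_apply, smul_eq_mul]
    linarith

theorem mem_nonnegRates_of_conMSE {ϖ : Weights K} {w : Receivers N K} {x : Alloc N K}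
    (h : ∀ i, S.conMSE i (ϖ, w, x) ≤ 0) : x ∈ nonnegRates N K := fun k =>
  neg_nonpos.1 (h (.nonnegB k))

theorem convex_subFeasible {ϖ : Weights K} (hϖ : WeightsPos ϖ) (w : Receivers N K) :
    Convex ℝ (S.subFeasible ϖ w) := by
  intro x hx y hy a b ha hb hab i
  have hx' := S.mem_nonnegRates_of_conMSE hx
  have hy' := S.mem_nonnegRates_of_conMSE hy
  refine ((S.convexOn_conMSE hϖ w i).2 hx' hy' ha hb hab).trans ?_
  exact add_nonpos (mul_nonpos_of_nonneg_of_nonpos ha (hx i))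
    (mul_nonpos_of_nonneg_of_nonpos hb (hy i))

/-! ### Compactness -/

/-- Feasible set of the original problem. -/
def rateFeasible : Set (Alloc N K) := {x | ∀ i, S.conRate i x ≤ 0}

theorem isClosed_rateFeasible : IsClosed S.rateFeasible := by
  simp only [rateFeasible, Set.ofPred_forall]
  exact isClosed_iInter fun i =>
    isClosed_le (S.differentiable_conRate i).continuous continuous_const

/-- The power budget bounds `p` and `r_b`; the downlink rate, bounded by `B * D` on the ball
containing `p`, then bounds `r_c`. -/
theorem isCompact_rateFeasible : IsCompact S.rateFeasible := by
  have hκ := S.κ_pos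
  have hφ := S.φ_pos
  have hc : 0 < S.κ * S.φ ^ 3 := by positivity
  obtain ⟨D, hD⟩ := (isCompact_closedBall (0 : Fin N → ℂ) (Real.sqrt S.Pb)).bddAbove_image
    (S.differentiable_rateD.continuous.continuousOn)
  refine IsCompact.of_isClosed_subset
    ((isCompact_Icc (a := (0 : Fin K → ℝ)) (b := fun _ => 1 + S.Pb / (S.κ * S.φ ^ 3))).prod
      ((isCompact_Icc (a := (0 : Fin K → ℝ)) (b := fun _ => S.B * D)).prod
        (isCompact_closedBall (0 : Fin N → ℂ) (Real.sqrt S.Pb)))) S.isClosed_rateFeasible ?_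
  intro x hx
  have hb : ∀ k, 0 ≤ x.1 k := fun k => neg_nonpos.1 (hx (.nonnegB k))
  have hr : ∀ k, 0 ≤ x.2.1 k := fun k => neg_nonpos.1 (hx (.nonnegC k))
  have hpow : ∑ k, S.κ * (S.φ * x.1 k) ^ 3 + ∑ n, ‖x.2.2 n‖ ^ 2 - S.Pb ≤ 0 := hx .power
  have hdown : ∑ k, x.2.1 k - S.B * S.rateD x.2.2 ≤ 0 := hx .downlink
  have hterm : ∀ k ∈ Finset.univ, 0 ≤ S.κ * (S.φ * x.1 k) ^ 3 := fun k _ => by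
    have := hb k
    positivity
  have hterm' : ∀ n ∈ Finset.univ, 0 ≤ ‖x.2.2 n‖ ^ 2 := fun n _ => by positivity
  have hp : x.2.2 ∈ Metric.closedBall (0 : Fin N → ℂ) (Real.sqrt S.Pb) := by
    rw [mem_closedBall_zero_iff, pi_norm_le_iff_of_nonneg (Real.sqrt_nonneg _)]
    intro n
    apply Real.le_sqrt_of_sq_le
    have := Finset.single_le_sum hterm' (Finset.mem_univ n)
    have := Finset.sum_nonneg hterm
    linarith
  refine ⟨⟨hb, fun k => ?_⟩, ⟨hr, fun k => ?_⟩, hp⟩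
  · have h1 := Finset.single_le_sum hterm (Finset.mem_univ k)
    have h2 := Finset.sum_nonneg hterm'
    have h3 : x.1 k ^ 3 ≤ S.Pb / (S.κ * S.φ ^ 3) := by
      rw [le_div_iff₀ hc]
      linarith
    have h4 : 0 ≤ x.1 k ^ 3 := pow_nonneg (hb k) 3
    -- Either `r ≤ 1` or `r ≤ r ^ 3`; hence the bound `1 + Pb / (κ φ³)`, which avoids cube roots.
    rcases le_total (x.1 k) 1 with h | h
    · linarith
    · have := le_self_pow₀ h (three_ne_zero)
      linarith
  · have h1 := Finset.single_le_sum (fun k _ => hr k) (Finset.mem_univ k)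
    have h2 := mul_le_mul_of_nonneg_left (hD ⟨x.2.2, hp, rfl⟩) S.B_pos.le
    linarith

theorem subFeasible_subset {ϖ : Weights K} (hϖ : WeightsPos ϖ) (w : Receivers N K) :
    S.subFeasible ϖ w ⊆ S.rateFeasible := fun x hx i =>
  (S.conRate_le_conMSE i (z := (ϖ, w, x)) hϖ).trans (hx i)

theorem differentiable_conMSE_right {ϖ : Weights K} (hϖ : WeightsPos ϖ) (w : Receivers N K)
    (i : Con K) : Differentiable ℝ fun x => S.conMSE i (ϖ, w, x) := fun x => by
  have hx : DifferentiableAt ℝ (fun x : Alloc N K => ((ϖ, w, x) : Point N K)) x :=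
    (differentiableAt_const ϖ).prodMk ((differentiableAt_const w).prodMk differentiableAt_id)
  have h := DifferentiableAt.comp x (S.differentiableAt_conMSE i (z := (ϖ, w, x)) hϖ) hx
  simpa only [Function.comp_def] using h

theorem isCompact_subFeasible {ϖ : Weights K} (hϖ : WeightsPos ϖ) (w : Receivers N K) :
    IsCompact (S.subFeasible ϖ w) := by
  refine S.isCompact_rateFeasible.of_isClosed_subset ?_ (S.subFeasible_subset hϖ w)
  simp only [subFeasible, Set.ofPred_forall]
  exact isClosed_iInter fun i =>
    isClosed_le (S.differentiable_conMSE_right hϖ w i).continuous continuous_const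

theorem mem_subFeasible_mmse {x : Alloc N K} (hx : x ∈ S.rateFeasible) :
    x ∈ S.subFeasible (S.mmseWeights x.2.2) (S.mmseReceivers x.2.2) := fun i =>
  (S.conMSE_mmse i x).trans_le (hx i)

theorem exists_isRun (p₀ : Fin N → ℂ)
    (h₀ : (S.subFeasible (S.mmseWeights p₀) (S.mmseReceivers p₀)).Nonempty) :
    ∃ ϖ w x, S.IsRun ϖ w x ∧ (x 0).2.2 = p₀ := by
  -- Nonemptiness is placed inside the statement so that the chosen `next` is total; its value `0`
  -- for infeasible subproblems is never reached.
  have hstep : ∀ p, ∃ y : Alloc N K,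
      (S.subFeasible (S.mmseWeights p) (S.mmseReceivers p)).Nonempty →
      y ∈ S.subFeasible (S.mmseWeights p) (S.mmseReceivers p) ∧
      ∀ y' ∈ S.subFeasible (S.mmseWeights p) (S.mmseReceivers p), S.objective y' ≤ S.objective y := by
    intro p
    by_cases h : (S.subFeasible (S.mmseWeights p) (S.mmseReceivers p)).Nonempty
    · obtain ⟨y, hy, hmax⟩ := (S.isCompact_subFeasible (S.weightsPos_mmseWeights p)
        (S.mmseReceivers p)).exists_isMaxOn h S.differentiable_objective.continuous.continuousOn
      exact ⟨y, fun _ => ⟨hy, hmax⟩⟩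
    · exact ⟨0, fun h' => absurd h' h⟩
  choose next hnext using hstep
  let x : ℕ → Alloc N K := fun n => Nat.rec (0, 0, p₀) (fun _ y => next y.2.2) n
  have hx : ∀ n, x (n + 1) = next (x n).2.2 := fun _ => rfl
  have hne : ∀ n, (S.subFeasible (S.mmseWeights (x n).2.2) (S.mmseReceivers (x n).2.2)).Nonempty := by
    intro n
    induction n with
    | zero => exact h₀
    | succ n ih =>
      refine ⟨x (n + 1), S.mem_subFeasible_mmse ?_⟩
      exact S.subFeasible_subset (S.weightsPos_mmseWeights _) _ (hnext _ ih).1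
  -- Truncated subtraction only supplies unused entries at index `0`.
  exact ⟨fun n => S.mmseWeights (x (n - 1)).2.2, fun n => S.mmseReceivers (x (n - 1)).2.2, x,
    ⟨fun _ => rfl, fun _ => rfl, fun n => (hnext _ (hne n)).1, fun n => (hnext _ (hne n)).2⟩, rfl⟩

/-! ### Transfer of the KKT conditions -/

theorem _root_.JCSMC.isOpen_weightsPos : IsOpen {ϖ : Weights K | WeightsPos ϖ} := by
  simp only [WeightsPos, Set.ofPred_and, Set.ofPred_forall]
  exact (isOpen_iInter_of_finite fun k =>
      isOpen_lt continuous_const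
        ((continuous_apply k).comp (continuous_fst : Continuous fun ϖ : Weights K => ϖ.1))).inter
    ((isOpen_lt continuous_const continuous_snd.fst).inter
      (isOpen_lt continuous_const continuous_snd.snd))

/-- The allocation as a linear function of all the variables. -/
def _root_.JCSMC.allocProj (N K : ℕ) : Point N K →L[ℝ] Alloc N K :=
  (ContinuousLinearMap.snd ℝ (Receivers N K) (Alloc N K)).comp
    (ContinuousLinearMap.snd ℝ (Weights K) (Receivers N K × Alloc N K))

variable {S}

/-- Near `z` the weights stay positive, so the rate constraint lies below and touches at `z`. As it
ignores weights and receivers, the derivatives in those variables vanish. -/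
theorem IsMMSE.fderiv_conMSE {z : Point N K} (hz : S.IsMMSE z) (i : Con K) :
    fderiv ℝ (S.conMSE i) z = (fderiv ℝ (S.conRate i) z.2.2).comp (allocProj N K) := by
  have hr := HasFDerivAt.comp z (S.differentiable_conRate i (allocProj N K z)).hasFDerivAt
    (allocProj N K).hasFDerivAt
  refine Eq.trans ?_ hr.fderiv
  refine (fderiv_eq_of_touch hr.differentiableAt (S.differentiableAt_conMSE i hz.weightsPos)
    ?_ (hz.conMSE_eq i).symm).symm
  filter_upwards [continuous_fst.continuousAt.preimage_mem_nhds
    (isOpen_weightsPos.mem_nhds hz.weightsPos)] with z' hz'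
  exact S.conRate_le_conMSE i hz'

theorem IsMMSE.fderiv_conMSE_right {z : Point N K} (hz : S.IsMMSE z) (i : Con K) :
    fderiv ℝ (fun x => S.conMSE i (z.1, z.2.1, x)) z.2.2 = fderiv ℝ (S.conRate i) z.2.2 :=
  (fderiv_eq_of_touch (S.differentiable_conRate i _)
    (S.differentiable_conMSE_right hz.weightsPos z.2.1 i _)
    (Eventually.of_forall fun x => S.conRate_le_conMSE i (z := (z.1, z.2.1, x)) hz.weightsPos)
    (hz.conMSE_eq i).symm).symm

theorem IsMMSE.isKKTMSE {z : Point N K} (hz : S.IsMMSE z) (h : S.IsKKTRate z.2.2) :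
    S.IsKKTMSE z := by
  obtain ⟨hf, -, hfeas, μ, hμ, hcs, hstat⟩ := h
  have hobj := HasFDerivAt.comp z (show DifferentiableAt ℝ S.objective (allocProj N K z) from hf).hasFDerivAt
    (allocProj N K).hasFDerivAt
  refine ⟨hz.weightsPos, hobj.differentiableAt,
    fun i => S.differentiableAt_conMSE i hz.weightsPos, fun i => (hz.conMSE_eq i).trans_le (hfeas i),
    μ, hμ, fun i => by rw [hz.conMSE_eq i]; exact hcs i, ?_⟩
  refine hobj.fderiv.trans ?_
  have hstat' : fderiv ℝ S.objective (allocProj N K z) = ∑ i, μ i • fderiv ℝ (S.conRate i) z.2.2 :=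
    hstat
  rw [hstat']
  refine ContinuousLinearMap.ext fun v => ?_
  simp only [hz.fderiv_conMSE, ContinuousLinearMap.comp_apply, sum_apply, smul_apply]

/-- If no allocation that is strictly feasible for the subproblem at an MMSE point is better, then
Slater's condition makes this point a KKT point. -/
theorem IsMMSE.isKKTRate {z : Point N K} (hz : S.IsMMSE z) (hfeas : z.2.2 ∈ S.rateFeasible)
    (hopt : ∀ y, (∀ i, S.conMSE i (z.1, z.2.1, y) < 0) → S.objective y ≤ S.objective z.2.2)
    (hsl : S.Slater z.1 z.2.1) : S.IsKKTRate z.2.2 := by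
  obtain ⟨x₀, hx₀⟩ := hsl
  have hright := fun i => S.differentiable_conMSE_right hz.weightsPos z.2.1 i z.2.2
  have hval : ∀ i, S.conMSE i (z.1, z.2.1, z.2.2) = S.conRate i z.2.2 := hz.conMSE_eq
  have hle : ∀ i, S.conMSE i (z.1, z.2.1, z.2.2) ≤ 0 := fun i => (hval i).trans_le (hfeas i)
  refine isKKTPoint_of_no_ascent (S.differentiable_objective _)
    (fun i => S.differentiable_conRate i _) hfeas ?_ (x₀ - z.2.2) ?_
  · intro d hd hact
    -- A first-order ascent direction would yield a strictly feasible and strictly better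
    -- allocation, against `hopt`.
    have h1 : ∀ i, ∀ᶠ t : ℝ in 𝓝[>] 0, S.conMSE i (z.1, z.2.1, z.2.2 + t • d) < 0 := fun i =>
      eventually_neg_of_fderiv_neg (hright i) (hle i) fun h0 => by
        rw [hz.fderiv_conMSE_right]
        exact hact i ((hval i).symm.trans h0)
    have h2 : ∀ᶠ t : ℝ in 𝓝[>] 0, S.objective z.2.2 - S.objective (z.2.2 + t • d) < 0 := by
      refine eventually_neg_of_fderiv_neg
        (g := fun y => S.objective z.2.2 - S.objective y)
        ((differentiableAt_const _).fun_sub (S.differentiable_objective _)) (sub_self _).le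
        fun _ => ?_
      rw [fderiv_const_sub]
      simpa using hd
    obtain ⟨t, ht1, ht2⟩ := ((eventually_all.2 h1).and h2).exists
    linarith [hopt _ ht1]
  -- The direction towards the Slater point decreases every active constraint, by the gradient
  -- inequality.
  · intro i hi
    rw [← hz.fderiv_conMSE_right]
    refine (fderiv_sub_le_of_convexOn (S.convexOn_conMSE hz.weightsPos z.2.1 i)
      (S.mem_nonnegRates_of_conMSE hle)
      (S.mem_nonnegRates_of_conMSE fun i => (hx₀ i).le) (hright i)).trans_lt ?_
    rw [hval, hi, sub_zero]
    exact hx₀ i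

/-! ### Runs of the algorithm -/

theorem _root_.JCSMC.mem_of_mapClusterPt_of_isClosed {X : Type*} [TopologicalSpace X] {u : ℕ → X}
    {C : Set X} (hC : IsClosed C) (hu : ∀ᶠ n in atTop, u n ∈ C) {z : X}
    (hz : MapClusterPt z atTop u) : z ∈ C := by
  by_contra h
  obtain ⟨n, hn, hn'⟩ := ((hz.frequently (hC.isOpen_compl.mem_nhds h)).and_eventually hu).exists
  exact hn hn'

theorem _root_.JCSMC.eq_of_mapClusterPt_of_tendsto {X Y : Type*} [TopologicalSpace X]
    [TopologicalSpace Y] [T2Space Y] {u : ℕ → X} {f : X → Y} (hf : Continuous f) {z : X} {v : Y}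
    (hz : MapClusterPt z atTop u) (hv : Tendsto (fun n => f (u n)) atTop (𝓝 v)) : f z = v := by
  have h : ClusterPt (f z) (map (f ∘ u) atTop) := hz.continuousAt_comp hf.continuousAt
  exact eq_of_nhds_neBot (h.mono hv)

/-- The point with given allocation and the MMSE weights and receivers. -/
def mmsePoint (S : System N K M) (x : Alloc N K) : Point N K :=
  (S.mmseWeights x.2.2, S.mmseReceivers x.2.2, x)

theorem continuous_mmsePoint : Continuous S.mmsePoint :=
  (S.continuous_mmseWeights.comp continuous_snd.snd).prodMk
    ((S.continuous_mmseReceivers.comp continuous_snd.snd).prodMk continuous_id)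

theorem _root_.JCSMC.mapClusterPt_of_tendsto {ϖ : ℕ → Weights K} {w : ℕ → Receivers N K} {x : ℕ → Alloc N K}
    {z : Point N K}
    (hz : Tendsto (fun n => (ϖ n, w n, x n)) atTop (𝓝 z)) :
    MapClusterPt z atTop fun n => (ϖ (n + 1), w (n + 1), x n) := by
  have h1 := hz.fst_nhds
  have h2 := hz.snd_nhds
  have h3 : Tendsto (fun n => (ϖ (n + 1), w (n + 1), x n)) atTop (𝓝 z) :=
    (h1.comp (tendsto_add_atTop_nat 1)).prodMk_nhds
      ((h2.fst_nhds.comp (tendsto_add_atTop_nat 1)).prodMk_nhds h2.snd_nhds)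
  exact h3.mapClusterPt

namespace IsRun

variable {ϖ : ℕ → Weights K} {w : ℕ → Receivers N K} {x : ℕ → Alloc N K} (h : S.IsRun ϖ w x)
include h

theorem weightsPos (n : ℕ) : WeightsPos (ϖ (n + 1)) := by
  rw [h.weights]
  exact S.weightsPos_mmseWeights _

theorem mem_rateFeasible (n : ℕ) : x (n + 1) ∈ S.rateFeasible :=
  S.subFeasible_subset (h.weightsPos n) _ (h.feasible n)

/-- The reason for the shifted pairing: weights and receivers are exactly MMSE for the beamformer
beside them. -/
theorem mmsePoint_eq (n : ℕ) : S.mmsePoint (x n) = (ϖ (n + 1), w (n + 1), x n) := by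
  rw [mmsePoint, h.weights, h.receivers]

theorem monotone_objective : Monotone fun n => S.objective (x (n + 1)) :=
  monotone_nat_of_le_succ fun n => h.optimal (n + 1) _ (by
    rw [h.weights, h.receivers]
    exact S.mem_subFeasible_mmse (h.mem_rateFeasible n))

theorem bddAbove_objective : BddAbove (Set.range fun n => S.objective (x (n + 1))) := by
  refine (S.isCompact_rateFeasible.bddAbove_image
    S.differentiable_objective.continuous.continuousOn).mono ?_
  rintro _ ⟨n, rfl⟩
  exact ⟨_, h.mem_rateFeasible n, rfl⟩

theorem tendsto_objective : Tendsto (fun n => S.objective (x n)) atTop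
    (𝓝 (⨆ n, S.objective (x (n + 1)))) :=
  (tendsto_add_atTop_iff_nat 1).1 (tendsto_atTop_ciSup h.monotone_objective h.bddAbove_objective)

theorem eventually_mem : ∀ᶠ n in atTop,
    -- Only eventually, because the allocation `x 0` need not be feasible.
    (ϖ (n + 1), w (n + 1), x n) ∈ S.mmsePoint '' S.rateFeasible := by
  filter_upwards [eventually_ge_atTop 1] with n hn
  obtain ⟨m, rfl⟩ := Nat.exists_eq_succ_of_ne_zero (Nat.one_le_iff_ne_zero.1 hn)
  exact ⟨_, h.mem_rateFeasible m, h.mmsePoint_eq _⟩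

theorem objective_eq {z : Point N K}
    (hz : MapClusterPt z atTop fun n => (ϖ (n + 1), w (n + 1), x n)) :
    S.objective z.2.2 = ⨆ n, S.objective (x (n + 1)) := by
  have hc : Continuous fun z : Point N K => S.objective z.2.2 :=
    S.differentiable_objective.continuous.comp continuous_snd.snd
  exact eq_of_mapClusterPt_of_tendsto hc hz h.tendsto_objective

theorem isMMSE_and_feasible {z : Point N K}
    (hz : MapClusterPt z atTop fun n => (ϖ (n + 1), w (n + 1), x n)) :
    S.IsMMSE z ∧ z.2.2 ∈ S.rateFeasible := by
  obtain ⟨y, hy, rfl⟩ := mem_of_mapClusterPt_of_isClosed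
    (S.isCompact_rateFeasible.image continuous_mmsePoint).isClosed h.eventually_mem hz
  exact ⟨⟨rfl, rfl⟩, hy⟩

/-- Strict feasibility of `y` is an open condition on weights and receivers, so `y` competes in
infinitely many subproblems. Monotone values then suffice: `x (n + 1)` need not approach `z.2.2`. -/
theorem objective_le {z : Point N K}
    (hz : MapClusterPt z atTop fun n => (ϖ (n + 1), w (n + 1), x n)) {y : Alloc N K}
    (hy : ∀ i, S.conMSE i (z.1, z.2.1, y) < 0) : S.objective y ≤ S.objective z.2.2 := by
  have hpos := (h.isMMSE_and_feasible hz).1.weightsPos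
  have hnhds : ∀ᶠ z' in 𝓝 z, ∀ i, S.conMSE i (z'.1, z'.2.1, y) < 0 := by
    refine eventually_all.2 fun i => ?_
    have hc : ContinuousAt (fun z' : Point N K => S.conMSE i (z'.1, z'.2.1, y)) z :=
      ContinuousAt.comp (f := fun z' : Point N K => ((z'.1, z'.2.1, y) : Point N K))
        (S.differentiableAt_conMSE i (z := (z.1, z.2.1, y)) hpos).continuousAt
        (continuous_fst.prodMk (continuous_snd.fst.prodMk continuous_const)).continuousAt
    exact hc.eventually_lt continuousAt_const (hy i)
  obtain ⟨n, hn⟩ := (hz.frequently hnhds).exists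
  rw [h.objective_eq hz]
  exact (h.optimal n y fun i => (hn i).le).trans (le_ciSup h.bddAbove_objective n)

theorem isKKT {z : Point N K}
    (hz : MapClusterPt z atTop fun n => (ϖ (n + 1), w (n + 1), x n)) (hsl : S.Slater z.1 z.2.1) :
    S.IsKKTMSE z ∧ S.IsKKTRate z.2.2 := by
  obtain ⟨hm, hf⟩ := h.isMMSE_and_feasible hz
  have hr := hm.isKKTRate hf (fun y hy => h.objective_le hz hy) hsl
  exact ⟨hm.isKKTMSE hr, hr⟩

end IsRun

end System
end JCSMC
end

theorem proposition2 {N K M : ℕ} (S : JCSMC.System N K M) :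
    -- the algorithm can be run from every beamformer for which the first subproblem is feasible
    (∀ p₀ : Fin N → ℂ, (S.subFeasible (S.mmseWeights p₀) (S.mmseReceivers p₀)).Nonempty →
      ∃ ϖ w x, S.IsRun ϖ w x ∧ (x 0).2.2 = p₀) ∧
    ∀ (ϖ : ℕ → JCSMC.Weights K) (w : ℕ → JCSMC.Receivers N K) (x : ℕ → JCSMC.Alloc N K),
      S.IsRun ϖ w x →
      -- the subproblems are convex
      (∀ n, Convex ℝ (S.subFeasible (ϖ (n + 1)) (w (n + 1)))) ∧
      -- the objective value is non-decreasing, bounded and convergent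
      Monotone (fun n => S.objective (x (n + 1))) ∧
      BddAbove (Set.range fun n => S.objective (x (n + 1))) ∧
      (∃ v : ℝ, Tendsto (fun n => S.objective (x n)) atTop (𝓝 v) ∧
        ∀ z : JCSMC.Point N K, MapClusterPt z atTop (fun n => (ϖ (n + 1), w (n + 1), x n)) →
          S.objective z.2.2 = v) ∧
      -- the iterates are bounded and have a cluster point
      Bornology.IsBounded (Set.range fun n => (ϖ (n + 1), w (n + 1), x n)) ∧
      (∃ z : JCSMC.Point N K, MapClusterPt z atTop (fun n => (ϖ (n + 1), w (n + 1), x n))) ∧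
      -- every cluster point satisfies the MMSE conditions, is feasible, and is a KKT point
      (∀ z : JCSMC.Point N K, MapClusterPt z atTop (fun n => (ϖ (n + 1), w (n + 1), x n)) →
        S.IsMMSE z ∧ (∀ i, S.conMSE i z ≤ 0) ∧ (∀ i, S.conRate i z.2.2 ≤ 0) ∧
        (S.Slater z.1 z.2.1 → S.IsKKTMSE z ∧ S.IsKKTRate z.2.2)) ∧
      -- the same for the limit of the iterates, if they converge
      (∀ z : JCSMC.Point N K, Tendsto (fun n => (ϖ n, w n, x n)) atTop (𝓝 z) →
        S.IsMMSE z ∧ (S.Slater z.1 z.2.1 → S.IsKKTMSE z ∧ S.IsKKTRate z.2.2)) ∧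
      -- the iterates approach the set of KKT points that satisfy the MMSE conditions
      ((∀ z : JCSMC.Point N K, MapClusterPt z atTop (fun n => (ϖ (n + 1), w (n + 1), x n)) →
          S.Slater z.1 z.2.1) →
        Tendsto (fun n => Metric.infDist (ϖ (n + 1), w (n + 1), x n)
          {z : JCSMC.Point N K | S.IsKKTMSE z ∧ S.IsMMSE z ∧ S.IsKKTRate z.2.2})
          atTop (𝓝 0)) := by
  refine ⟨S.exists_isRun, fun ϖ w x h => ?_⟩
  have hC : IsCompact (S.mmsePoint '' S.rateFeasible) :=
    S.isCompact_rateFeasible.image JCSMC.System.continuous_mmsePoint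
  refine ⟨fun n => S.convex_subFeasible (h.weightsPos n) _, h.monotone_objective,
    h.bddAbove_objective, ⟨_, h.tendsto_objective, fun z hz => h.objective_eq hz⟩, ?_, ?_,
    fun z hz => ?_, fun z hz => ?_, fun hsl => ?_⟩
  -- The initial point may lie outside the compact set and is added by hand.
  · refine (hC.isBounded.insert (ϖ 1, w 1, x 0)).subset ?_
    rintro _ ⟨n, rfl⟩
    cases n with
    | zero => exact Set.mem_insert _ _
    | succ n => exact Set.mem_insert_of_mem _ ⟨_, h.mem_rateFeasible n, h.mmsePoint_eq _⟩
  · obtain ⟨z, -, hz⟩ := hC.exists_mapClusterPt_of_frequently h.eventually_mem.frequently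
    exact ⟨z, hz⟩
  · obtain ⟨hm, hf⟩ := h.isMMSE_and_feasible hz
    exact ⟨hm, fun i => (hm.conMSE_eq i).trans_le (hf i), hf, h.isKKT hz⟩
  · have hz' := JCSMC.mapClusterPt_of_tendsto hz
    exact ⟨(h.isMMSE_and_feasible hz').1, h.isKKT hz'⟩
  -- A cluster point exists and lies in the target set, so the default value `0` of `infDist` for
  -- the empty set plays no role.
  · refine JCSMC.tendsto_infDist_of_mapClusterPt_mem hC h.eventually_mem fun z hz => ?_
    obtain ⟨h1, h2⟩ := h.isKKT hz (hsl z hz)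
    exact ⟨h1, (h.isMMSE_and_feasible hz).1, h2⟩
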